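/- Let $\mathbb H=\{z=x+iy : y>0\}$ be the upper half-plane with the Poincaré metric $ds^2=y^{-2}(dx^2+dy^2)$, hyperbolic area $\mathrm{Leb}=y^{-2}\,dx\,dy$ and Laplacian $\Delta=y^2(\partial_x^2+\partial_y^2)$. Let $\pi:T^1\mathbb H\to\mathbb H$ be its unit tangent bundle. The geodesic flow moves a unit vector $v$ at unit speed along the geodesic $c_v$ that it directs. The unstable horocyclic flow moves $v$ at unit speed along the horocycle through $\pi(v)$ centred at the backward endpoint $c_v(-\infty)$, keeping the vector orthogonal to this horocycle and its backward endpoint fixed. A measure on $T^1\mathbb H$ is called invariant by the joint action if it is invariant under both flows. A Borel measure $m$ on $\mathbb H$ is called harmonic if $m=h\,\mathrm{Leb}$ for a function $h:\mathbb H\to(0,\infty)$ of class $C^2$ with $\Delta h=0$. **Proposition 1.1 (Brunella's proposition on $\mathbb H$).** 1. A Borel measure $m$ on $\mathbb H$ is harmonic if and only if $m=\pi_*\mu$ for some nonzero locally finite Borel measure $\mu$ on $T^1\mathbb H$ that is invariant by the joint action of the geodesic and unstable horocyclic flows. 2. If $\mu_1\neq\mu_2$ are two locally finite Borel measures on $T^1\mathbb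 H$ that are invariant by the joint action, then $\pi_*\mu_1\ne\pi_*\mu_2$. -/

import Mathlib

open MeasureTheory UpperHalfPlane

noncomputable section

namespace HypPlane

/-! ### The unit tangent bundle of the hyperbolic plane -/

/-- The unit tangent bundle `T¹ℍ` of the upper half-plane with the Poincaré metric
`ds² = y⁻² (dx² + dy²)`. Tangent vectors at `z` are complex numbers `w`, and the Riemannian norm
of `w` at `z` is `‖w‖ / Im z`, so that unit vectors are those with `‖w‖ = Im z`. The topology and
the Borel σ-algebra are those induced from `ℍ × ℂ`. -/
abbrev UnitTangent : Type := {p : ℍ × ℂ // ‖p.2‖ = p.1.im}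

namespace UnitTangent

/-- The base point of a unit tangent vector; this is the projection `T¹ℍ → ℍ`. -/
def base (v : UnitTangent) : ℍ := v.1.1

/-- The vector part of a unit tangent vector. -/
def vec (v : UnitTangent) : ℂ := v.1.2

/-- The direction of a unit tangent vector, as a complex number of modulus one; the vertical
upward direction is `1`. -/
def dir (v : UnitTangent) : ℂ := v.vec / (Complex.I * (v.base.im : ℂ))

/-- The denominator of the frame of `v` moved by the matrix with rows `(a, b)`, `(b̄, ā)`. -/
def denom (a b : ℂ) (v : UnitTangent) : ℂ := starRingEnd ℂ a - v.dir * b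

theorem ext' {v w : UnitTangent} (h₁ : (v.base : ℂ) = w.base) (h₂ : v.vec = w.vec) : v = w :=
  Subtype.ext (Prod.ext (UpperHalfPlane.ext h₁) h₂)

theorem norm_vec (v : UnitTangent) : ‖v.vec‖ = v.base.im := v.2

theorem im_ne (v : UnitTangent) : (v.base.im : ℂ) ≠ 0 :=
  Complex.ofReal_ne_zero.2 v.base.im_ne_zero

theorem norm_dir (v : UnitTangent) : ‖v.dir‖ = 1 := by
  have h := v.base.im_pos
  rw [dir, norm_div, norm_mul, Complex.norm_I, one_mul, Complex.norm_real, v.norm_vec,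
    Real.norm_of_nonneg h.le, div_self h.ne']

theorem dir_mul_conj (v : UnitTangent) : v.dir * starRingEnd ℂ v.dir = 1 := by
  rw [Complex.mul_conj, Complex.normSq_eq_norm_sq, norm_dir]; simp

theorem vec_eq (v : UnitTangent) : v.vec = v.dir * (Complex.I * (v.base.im : ℂ)) := by
  have := v.im_ne
  rw [dir, div_mul_cancel₀]
  simpa using this

theorem base_conj (v : UnitTangent) :
    starRingEnd ℂ (v.base : ℂ) = v.base - 2 * Complex.I * (v.base.im : ℂ) := by
  apply Complex.ext
  · simp
  · simp
    ring

theorem denom_ne {a b : ℂ} (h : Complex.normSq a - Complex.normSq b = 1) (v : UnitTangent) :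
    v.denom a b ≠ 0 := by
  intro h0
  have h1 : starRingEnd ℂ a = v.dir * b := sub_eq_zero.1 h0
  have h2 : Complex.normSq a = Complex.normSq b := by
    have := congrArg Complex.normSq h1
    rwa [Complex.normSq_conj, Complex.normSq_mul, Complex.normSq_eq_norm_sq v.dir, norm_dir,
      one_pow, one_mul] at this
  linarith

theorem im_move {a b : ℂ} (h : Complex.normSq a - Complex.normSq b = 1) (v : UnitTangent) :
    (((v.base : ℂ) * starRingEnd ℂ a - starRingEnd ℂ (v.base : ℂ) * v.dir * b)
      / v.denom a b).im = v.base.im / Complex.normSq (v.denom a b) := by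
  have hn : Complex.normSq (v.denom a b) ≠ 0 := by simpa using v.denom_ne h
  have hu : v.dir.re ^ 2 + v.dir.im ^ 2 = 1 := by
    have := Complex.normSq_eq_norm_sq v.dir
    rw [norm_dir, Complex.normSq_apply] at this
    linarith
  rw [Complex.div_im, ← sub_div]
  congr 1
  simp only [denom, Complex.normSq_apply] at *
  simp
  linear_combination v.base.im * h - v.base.im * (b.re ^ 2 + b.im ^ 2) * hu

/-- The right action of the isometry group `PSU(1,1)` of the unit disc (with its Poincaré metric,
conjugate to `PSL₂(ℝ)`) on unit tangent vectors.

A unit tangent vector `v = (z, w)` with direction `α` is the same as the orientation preserving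
isometry `φ_v ζ = (z - z̄ α ζ) / (1 - α ζ)` from the unit disc onto `ℍ`, the one with `φ_v 0 = z`
and `φ_v' 0 = 2 w`. Here `v.move a b` is the unit vector that corresponds to `φ_v ∘ M`, where
`M ζ = (a ζ + b) / (b̄ ζ + ā)`: its base point is `φ_v (b / ā)`, its vector is
`w / (ā - α b) ^ 2`. -/
def move (a b : ℂ) (h : Complex.normSq a - Complex.normSq b = 1) (v : UnitTangent) :
    UnitTangent :=
  ⟨(⟨((v.base : ℂ) * starRingEnd ℂ a - starRingEnd ℂ (v.base : ℂ) * v.dir * b) / v.denom a b, by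
      rw [im_move h]
      exact div_pos v.base.im_pos (Complex.normSq_pos.2 (v.denom_ne h))⟩,
    v.vec / v.denom a b ^ 2), by
    rw [norm_div, norm_pow, v.norm_vec, ← Complex.normSq_eq_norm_sq]
    exact (im_move h v).symm⟩

theorem base_move {a b : ℂ} (h : Complex.normSq a - Complex.normSq b = 1) (v : UnitTangent) :
    ((v.move a b h).base : ℂ) =
      ((v.base : ℂ) * starRingEnd ℂ a - starRingEnd ℂ (v.base : ℂ) * v.dir * b) / v.denom a b :=
  rfl

theorem vec_move {a b : ℂ} (h : Complex.normSq a - Complex.normSq b = 1) (v : UnitTangent) :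
    (v.move a b h).vec = v.vec / v.denom a b ^ 2 :=
  rfl

theorem im_base_move {a b : ℂ} (h : Complex.normSq a - Complex.normSq b = 1) (v : UnitTangent) :
    (v.move a b h).base.im = v.base.im / Complex.normSq (v.denom a b) :=
  im_move h v

theorem base_move' {a b : ℂ} (h : Complex.normSq a - Complex.normSq b = 1) (v : UnitTangent) :
    ((v.move a b h).base : ℂ) =
      (v.base : ℂ) + 2 * Complex.I * (v.base.im : ℂ) * (v.dir * b) / v.denom a b := by
  have := v.denom_ne h
  rw [base_move, base_conj, div_eq_iff this, add_mul, div_mul_cancel₀ _ this, denom]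
  ring

theorem dir_move {a b : ℂ} (h : Complex.normSq a - Complex.normSq b = 1) (v : UnitTangent) :
    (v.move a b h).dir = v.dir * starRingEnd ℂ (v.denom a b) / v.denom a b := by
  have h1 := v.denom_ne h
  have h2 : starRingEnd ℂ (v.denom a b) ≠ 0 := by simpa using h1
  have h3 := v.im_ne
  rw [dir, vec_move, im_base_move, vec_eq]
  push_cast
  rw [← Complex.mul_conj]
  field_simp [Complex.I_ne_zero]

theorem move_move {a b a' b' : ℂ} (h : Complex.normSq a - Complex.normSq b = 1)
    (h' : Complex.normSq a' - Complex.normSq b' = 1) {A B : ℂ}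
    (H : Complex.normSq A - Complex.normSq B = 1)
    (hA : A = a * a' + b * starRingEnd ℂ b') (hB : B = a * b' + b * starRingEnd ℂ a')
    (v : UnitTangent) : (v.move a b h).move a' b' h' = v.move A B H := by
  have h1 := v.denom_ne h
  have h2 := (v.move a b h).denom_ne h'
  have h3 := v.denom_ne H
  have key : v.denom A B = v.denom a b * (v.move a b h).denom a' b' := by
    have hd := v.dir_mul_conj
    rw [denom, denom.eq_1 a' b', dir_move, mul_sub, ← mul_assoc, mul_div_cancel₀ _ h1]
    simp only [denom, hA, hB, map_add, map_mul, map_sub, Complex.conj_conj]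
    linear_combination (-starRingEnd ℂ b * b') * hd
  have hn : a * starRingEnd ℂ a - b * starRingEnd ℂ b = 1 := by
    rw [Complex.mul_conj, Complex.mul_conj]
    exact_mod_cast h
  apply ext'
  · have h4 : starRingEnd ℂ (v.denom a b) ≠ 0 := by simpa using h1
    have e : B * v.denom a b = b * (v.denom a b * (v.move a b h).denom a' b') + b' := by
      rw [← key]
      simp only [denom, hA, hB, map_add, map_mul, Complex.conj_conj]
      linear_combination b' * hn
    rw [base_move', base_move' h v, base_move' H v, im_base_move, dir_move, key]
    push_cast
    rw [← Complex.mul_conj]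
    field_simp
    linear_combination (-2 * Complex.I * (v.base.im : ℂ) * v.dir) * e
  · rw [vec_move, vec_move, vec_move, key, mul_pow, div_div]

theorem move_congr {a b a' b' : ℂ} (h : Complex.normSq a - Complex.normSq b = 1)
    (h' : Complex.normSq a' - Complex.normSq b' = 1) (ha : a = a') (hb : b = b')
    (v : UnitTangent) : v.move a b h = v.move a' b' h' := by
  subst ha hb
  rfl

theorem move_one {a b : ℂ} (h : Complex.normSq a - Complex.normSq b = 1) (ha : a = 1) (hb : b = 0)
    (v : UnitTangent) : v.move a b h = v := by
  subst ha hb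
  apply ext'
  · simp [base_move, denom]
  · simp [vec_move, denom]

theorem cosh_dist_move {a b : ℂ} (h : Complex.normSq a - Complex.normSq b = 1) (v : UnitTangent) :
    Real.cosh (dist v.base (v.move a b h).base) = 1 + 2 * ‖b‖ ^ 2 := by
  have h1 : ‖v.denom a b‖ ≠ 0 := by simpa using v.denom_ne h
  have h2 := v.base.im_ne_zero
  rw [UpperHalfPlane.cosh_dist, dist_comm, dist_eq_norm, base_move', add_sub_cancel_left,
    im_base_move, Complex.normSq_eq_norm_sq]
  simp only [norm_div, norm_mul, norm_dir, Complex.norm_I, Complex.norm_real, Complex.norm_ofNat,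
    Real.norm_eq_abs, abs_of_pos v.base.im_pos]
  field_simp

end UnitTangent

open UnitTangent

/-! ### The geodesic flow and the unstable horocyclic flow -/

/-- The geodesic flow on `T¹ℍ`: in the disc attached to `v`, the unit vector at `0` in the positive
real direction is transported along the unit speed geodesic `t ↦ tanh (t / 2)`. -/
def geodesicFlow (t : ℝ) (v : UnitTangent) : UnitTangent :=
  v.move (Real.cosh (t / 2) : ℝ) (Real.sinh (t / 2) : ℝ) (by
    simp only [Complex.normSq_ofReal]
    linarith [Real.cosh_sq (t / 2)])

/-- The unstable horocyclic flow on `T¹ℍ`: the vector `v` is transported at unit speed along the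
horocycle through its base point that is centred at the backward endpoint of its geodesic, and
remains orthogonal to this horocycle. In the disc attached to `v`, the backward endpoint is `-1`,
and the flow is given by the parabolic isometries with fixed point `-1`. -/
def horocycleFlow (s : ℝ) (v : UnitTangent) : UnitTangent :=
  v.move (1 + Complex.I * (s / 2 : ℝ)) (Complex.I * (s / 2 : ℝ)) (by
    simp [Complex.normSq_apply])

theorem geodesicFlow_zero (v : UnitTangent) : geodesicFlow 0 v = v := by
  exact move_one _ (by simp) (by simp) v

theorem geodesicFlow_add (s t : ℝ) (v : UnitTangent) :
    geodesicFlow (s + t) v = geodesicFlow t (geodesicFlow s v) := by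
  refine (move_move _ _ _ ?_ ?_ v).symm
  · rw [Complex.conj_ofReal, ← Complex.ofReal_mul, ← Complex.ofReal_mul, ← Complex.ofReal_add,
      ← Real.cosh_add, add_div]
  · rw [Complex.conj_ofReal, ← Complex.ofReal_mul, ← Complex.ofReal_mul, ← Complex.ofReal_add,
      add_comm (_ * _), ← Real.sinh_add, add_div]

/-- Along the geodesic flow, the base point moves with velocity the vector itself. -/
theorem hasDerivAt_geodesicFlow (t : ℝ) (v : UnitTangent) :
    HasDerivAt (fun r => ((geodesicFlow r v).base : ℂ)) (geodesicFlow t v).vec t := by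
  have hC : HasDerivAt (fun r : ℝ => ((Real.cosh (r / 2) : ℝ) : ℂ))
      ((Real.sinh (t / 2) * (1 / 2) : ℝ) : ℂ) t :=
    (((hasDerivAt_id t).div_const 2).cosh).ofReal_comp
  have hS : HasDerivAt (fun r : ℝ => ((Real.sinh (r / 2) : ℝ) : ℂ))
      ((Real.cosh (t / 2) * (1 / 2) : ℝ) : ℂ) t :=
    (((hasDerivAt_id t).div_const 2).sinh).ofReal_comp
  have hCS : ((Real.cosh (t / 2) : ℝ) : ℂ) ^ 2 - ((Real.sinh (t / 2) : ℝ) : ℂ) ^ 2 = 1 := by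
    exact_mod_cast Real.cosh_sq_sub_sinh_sq (t / 2)
  have hD (r : ℝ) : v.denom (Real.cosh (r / 2) : ℝ) (Real.sinh (r / 2) : ℝ) =
      (Real.cosh (r / 2) : ℝ) - v.dir * (Real.sinh (r / 2) : ℝ) := by
    rw [UnitTangent.denom, Complex.conj_ofReal]
  have hne : ((Real.cosh (t / 2) : ℝ) : ℂ) - v.dir * (Real.sinh (t / 2) : ℝ) ≠ 0 := by
    rw [← hD]
    exact v.denom_ne (by
      simp only [Complex.normSq_ofReal]
      linarith [Real.cosh_sq (t / 2)])
  have := ((((hS.const_mul v.dir).const_mul (2 * Complex.I * (v.base.im : ℂ))).div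
    (hC.sub (hS.const_mul v.dir)) hne)).const_add (v.base : ℂ)
  convert! this using 1
  · funext r
    rw [geodesicFlow, base_move', hD]
    rfl
  · rw [geodesicFlow, vec_move, hD, vec_eq]
    congr 1
    simp only [Pi.sub_apply, Complex.ofReal_mul]
    push_cast at hCS ⊢
    linear_combination (-v.dir * Complex.I * (v.base.im : ℂ)) * hCS

/-- The orbits of the geodesic flow are geodesic lines parametrized by arc length. -/
theorem dist_geodesicFlow (s t : ℝ) (v : UnitTangent) :
    dist (geodesicFlow s v).base (geodesicFlow t v).base = |s - t| := by
  have h : geodesicFlow t v = geodesicFlow (t - s) (geodesicFlow s v) := by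
    rw [← geodesicFlow_add]
    congr 1
    ring
  have h1 := cosh_dist_move (by
    simp only [Complex.normSq_ofReal]
    linarith [Real.cosh_sq ((t - s) / 2)]) (geodesicFlow s v)
    (a := (Real.cosh ((t - s) / 2) : ℝ)) (b := (Real.sinh ((t - s) / 2) : ℝ))
  have h2 : 1 + 2 * Real.sinh ((t - s) / 2) ^ 2 = Real.cosh (t - s) := by
    have := Real.cosh_two_mul ((t - s) / 2)
    rw [mul_div_cancel₀ _ two_ne_zero, Real.cosh_sq] at this
    linarith
  rw [Complex.norm_real, Real.norm_eq_abs, sq_abs, h2, ← Real.cosh_abs (t - s), abs_sub_comm] at h1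
  rw [h]
  have := congrArg Real.arcosh h1
  rwa [Real.arcosh_cosh dist_nonneg, Real.arcosh_cosh (abs_nonneg _)] at this

theorem horocycleFlow_zero (v : UnitTangent) : horocycleFlow 0 v = v := by
  exact move_one _ (by simp) (by simp) v

theorem horocycleFlow_add (s t : ℝ) (v : UnitTangent) :
    horocycleFlow (s + t) v = horocycleFlow t (horocycleFlow s v) := by
  refine (move_move _ _ _ ?_ ?_ v).symm
  · simp only [map_mul, Complex.conj_I, Complex.conj_ofReal]
    push_cast
    ring
  · simp only [map_add, map_one, map_mul, Complex.conj_I, Complex.conj_ofReal]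
    push_cast
    ring

/-- Along the horocyclic flow, the base point moves at unit speed and orthogonally to the
vector. -/
theorem hasDerivAt_horocycleFlow (s : ℝ) (v : UnitTangent) :
    HasDerivAt (fun r => ((horocycleFlow r v).base : ℂ))
      (Complex.I * (horocycleFlow s v).vec) s := by
  have hb : HasDerivAt (fun r : ℝ => Complex.I * ((r / 2 : ℝ) : ℂ))
      (Complex.I * ((1 / 2 : ℝ) : ℂ)) s :=
    (((hasDerivAt_id s).div_const 2).ofReal_comp).const_mul Complex.I
  have hD (r : ℝ) : v.denom (1 + Complex.I * (r / 2 : ℝ)) (Complex.I * (r / 2 : ℝ)) =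
      1 - (1 + v.dir) * (Complex.I * (r / 2 : ℝ)) := by
    simp only [UnitTangent.denom, map_add, map_one, map_mul, Complex.conj_I, Complex.conj_ofReal]
    ring
  have hne : 1 - (1 + v.dir) * (Complex.I * (s / 2 : ℝ)) ≠ 0 := by
    rw [← hD]
    exact v.denom_ne (by simp [Complex.normSq_apply])
  have := ((((hb.const_mul v.dir).const_mul (2 * Complex.I * (v.base.im : ℂ))).div
    ((hb.const_mul (1 + v.dir)).const_sub 1) hne)).const_add (v.base : ℂ)
  convert! this using 1
  · funext r
    rw [horocycleFlow, base_move', hD]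
    rfl
  · rw [horocycleFlow, vec_move, hD, vec_eq, mul_div_assoc']
    congr 1
    push_cast
    ring

/-- The geodesic flow expands the orbits of the unstable horocyclic flow; in other words, the
vectors `v` and `horocycleFlow s v` are asymptotic to each other in the past. -/
theorem geodesicFlow_horocycleFlow (s t : ℝ) (v : UnitTangent) :
    geodesicFlow t (horocycleFlow s v) = horocycleFlow (Real.exp t * s) (geodesicFlow t v) := by
  have e1 : Real.exp t * (Real.cosh (t / 2) - Real.sinh (t / 2)) =
      Real.cosh (t / 2) + Real.sinh (t / 2) := by
    rw [Real.cosh_sub_sinh, Real.cosh_add_sinh, ← Real.exp_add]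
    congr 1
    ring
  have e2 : (Real.exp t : ℂ) * ((Real.cosh (t / 2) : ℝ) - (Real.sinh (t / 2) : ℝ)) =
      (Real.cosh (t / 2) : ℝ) + (Real.sinh (t / 2) : ℝ) := by
    exact_mod_cast e1
  have H : Complex.normSq ((Real.cosh (t / 2) : ℝ) + Complex.I * (s / 2 : ℝ) *
      ((Real.cosh (t / 2) : ℝ) + (Real.sinh (t / 2) : ℝ))) -
      Complex.normSq ((Real.sinh (t / 2) : ℝ) + Complex.I * (s / 2 : ℝ) *
      ((Real.cosh (t / 2) : ℝ) + (Real.sinh (t / 2) : ℝ))) = 1 := by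
    have := Real.cosh_sq_sub_sinh_sq (t / 2)
    simp only [Complex.normSq_apply, ← Complex.ofReal_add, mul_assoc, ← Complex.ofReal_mul,
      Complex.add_re, Complex.add_im, Complex.ofReal_re, Complex.ofReal_im, Complex.I_mul_re,
      Complex.I_mul_im]
    linear_combination this
  refine (move_move _ _ H ?_ ?_ v).trans (move_move _ _ H ?_ ?_ v).symm
  · rw [Complex.conj_ofReal]
    ring
  · rw [Complex.conj_ofReal]
    ring
  · rw [← e2, map_mul, Complex.conj_I, Complex.conj_ofReal]
    push_cast
    ring
  · rw [← e2, map_add, map_one, map_mul, Complex.conj_I, Complex.conj_ofReal]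
    push_cast
    ring

/-- A measure on `T¹ℍ` is invariant under the joint action of the geodesic flow and of the unstable
horocyclic flow. -/
structure IsJointlyInvariant (μ : Measure UnitTangent) : Prop where
  geodesic : ∀ t : ℝ, MeasurePreserving (geodesicFlow t) μ μ
  horocycle : ∀ s : ℝ, MeasurePreserving (horocycleFlow s) μ μ

/-! ### Harmonic measures on the hyperbolic plane -/

/-- The Laplace-Beltrami operator `y² (∂²/∂x² + ∂²/∂y²)` of the Poincaré metric. -/
def hypLaplacian (h : ℍ → ℝ) (z : ℍ) : ℝ :=
  z.im ^ 2 * Laplacian.laplacian (fun w : ℂ => h (ofComplex w)) (z : ℂ)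

/-- A function on the hyperbolic plane is harmonic if it is of class `C²` and its Laplacian
vanishes. -/
def IsHarmonicFunction (h : ℍ → ℝ) : Prop :=
  (∀ z : ℍ, ContDiffAt ℝ 2 (fun w : ℂ => h (ofComplex w)) (z : ℂ)) ∧ ∀ z : ℍ, hypLaplacian h z = 0

/-- A Borel measure on the hyperbolic plane is harmonic if it has a positive harmonic density with
respect to the hyperbolic area `y⁻² dx dy`, which is Mathlib's `volume` on `ℍ`. -/
def IsHarmonicMeasure (m : Measure ℍ) : Prop :=
  ∃ h : ℍ → ℝ, (∀ z, 0 < h z) ∧ IsHarmonicFunction h ∧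
    m = (volume : Measure ℍ).withDensity (fun z => ENNReal.ofReal (h z))

end HypPlane

end

noncomputable section

namespace HypPlane

open UnitTangent

/-! ### Continuity of the flows -/

/-! A unit vector is determined by its base point and its backward endpoint ξ on the boundary
circle. Both flows fix ξ, and together they generate an affine group that acts simply transitively
on the leaf of vectors with backward endpoint ξ; this leaf projects bijectively onto ℍ. In the
coordinates (s, t) of `leafMap`, the measure ds dt is invariant under both flows. For ξ = ∞ it reads
dx dy / y, that is, y times the area, and y is the Poisson kernel of ∞; rotations about i extend
this to every ξ (`lintegral_base_leafMap`).

Hence a finite measure ν on the circle yields a jointly invariant measure `horoMeasure ν`, whose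
projection has the Poisson integral of ν as density (`map_base_horoMeasure`). Conversely, averaging
over the group shows that every locally finite jointly invariant measure has this form
(`IsJointlyInvariant.exists_eq_horoMeasure`).

What remains is classical potential theory, carried to the disc by the Cayley transform. Poisson
integrals of finite measures are harmonic (`isHarmonicFunction_poissonLIntegral`). Every positive
harmonic function is such an integral by Herglotz's theorem (`exists_integral_poissonKernel_eq`),
and the measure is unique (`eq_of_poissonLIntegral_eq`). Existence gives the first claim, uniqueness
the second. -/

theorem continuous_base : Continuous UnitTangent.base :=
  continuous_fst.comp continuous_subtype_val

theorem continuous_vec : Continuous UnitTangent.vec :=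
  continuous_snd.comp continuous_subtype_val

theorem continuous_dir : Continuous UnitTangent.dir := by
  refine continuous_vec.div ?_ fun v => mul_ne_zero Complex.I_ne_zero v.im_ne
  exact continuous_const.mul
    (Complex.continuous_ofReal.comp (UpperHalfPlane.continuous_im.comp continuous_base))

theorem continuous_move {X : Type*} [TopologicalSpace X] {a b : X → ℂ} {f : X → UnitTangent}
    (ha : Continuous a) (hb : Continuous b) (hf : Continuous f)
    (h : ∀ x, Complex.normSq (a x) - Complex.normSq (b x) = 1) :
    Continuous fun x => (f x).move (a x) (b x) (h x) := by
  have hd : Continuous fun x => (f x).denom (a x) (b x) :=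
    (Complex.continuous_conj.comp ha).sub ((continuous_dir.comp hf).mul hb)
  have hz : Continuous fun x => ((f x).base : ℂ) :=
    UpperHalfPlane.continuous_coe.comp (continuous_base.comp hf)
  refine Continuous.subtype_mk (Continuous.prodMk ?_ ?_) _
  · refine UpperHalfPlane.isOpenEmbedding_coe.isInducing.continuous_iff.2 ?_
    refine Continuous.div ?_ hd fun x => (f x).denom_ne (h x)
    exact (hz.mul (Complex.continuous_conj.comp ha)).sub
      (((Complex.continuous_conj.comp hz).mul (continuous_dir.comp hf)).mul hb)
  · exact (continuous_vec.comp hf).div (hd.pow 2) fun x =>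
      pow_ne_zero 2 ((f x).denom_ne (h x))

theorem _root_.Continuous.geodesicFlow {X : Type*} [TopologicalSpace X] {t : X → ℝ}
    {f : X → UnitTangent} (ht : Continuous t) (hf : Continuous f) :
    Continuous fun x => HypPlane.geodesicFlow (t x) (f x) := by
  refine continuous_move ?_ ?_ hf _
  · exact Complex.continuous_ofReal.comp (Real.continuous_cosh.comp (ht.div_const 2))
  · exact Complex.continuous_ofReal.comp (Real.continuous_sinh.comp (ht.div_const 2))

theorem _root_.Continuous.horocycleFlow {X : Type*} [TopologicalSpace X] {s : X → ℝ}
    {f : X → UnitTangent} (hs : Continuous s) (hf : Continuous f) :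
    Continuous fun x => HypPlane.horocycleFlow (s x) (f x) := by
  have h : Continuous fun x => Complex.I * ((s x / 2 : ℝ) : ℂ) :=
    continuous_const.mul (Complex.continuous_ofReal.comp (hs.div_const 2))
  exact continuous_move (continuous_const.add h) h hf _

theorem continuous_circleCoe : Continuous ((↑) : Circle → ℂ) := continuous_subtype_val

/-! ### Horocyclic coordinates -/

/-- The unit vector at `i` whose backward endpoint is the point `ξ` of the unit circle, seen as the
boundary of `ℍ` through the Cayley transform. -/
def startVec (ξ : Circle) : UnitTangent :=
  ⟨(UpperHalfPlane.I, -(ξ : ℂ) * Complex.I), by simp [Circle.norm_coe]⟩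

@[simp] theorem base_startVec (ξ : Circle) : (startVec ξ).base = UpperHalfPlane.I := rfl

@[simp] theorem dir_startVec (ξ : Circle) : (startVec ξ).dir = -ξ := by
  simp [dir, vec, startVec, base, mul_assoc]

theorem continuous_startVec : Continuous startVec := by
  refine Continuous.subtype_mk (continuous_const.prodMk ?_) _
  exact (continuous_circleCoe.neg).mul continuous_const

/-- The horocycle flow followed by the geodesic flow. -/
def leafMap (v : UnitTangent) (p : ℝ × ℝ) : UnitTangent :=
  geodesicFlow p.2 (horocycleFlow p.1 v)

theorem _root_.Continuous.leafMap {X : Type*} [TopologicalSpace X] {f : X → UnitTangent}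
    {p : X → ℝ × ℝ} (hf : Continuous f) (hp : Continuous p) :
    Continuous fun x => HypPlane.leafMap (f x) (p x) :=
  (continuous_snd.comp hp).geodesicFlow ((continuous_fst.comp hp).horocycleFlow hf)

theorem exists_leafMap_eq_move (p : ℝ × ℝ) : ∃ (a b : ℂ)
    (h : Complex.normSq a - Complex.normSq b = 1), ∀ v, leafMap v p = v.move a b h := by
  obtain ⟨s, t⟩ := p
  have H : Complex.normSq (((1 + Complex.I * (s / 2 : ℝ)) * (Real.cosh (t / 2) : ℝ) +
      Complex.I * (s / 2 : ℝ) * starRingEnd ℂ (Real.sinh (t / 2) : ℝ))) -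
      Complex.normSq (((1 + Complex.I * (s / 2 : ℝ)) * (Real.sinh (t / 2) : ℝ) +
      Complex.I * (s / 2 : ℝ) * starRingEnd ℂ (Real.cosh (t / 2) : ℝ))) = 1 := by
    have := Real.cosh_sq_sub_sinh_sq (t / 2)
    simp only [Complex.conj_ofReal]
    simp only [Complex.normSq_apply, Complex.add_re, Complex.add_im, Complex.mul_re,
      Complex.mul_im, Complex.ofReal_re, Complex.ofReal_im, Complex.I_re, Complex.I_im,
      Complex.one_re, Complex.one_im]
    linear_combination this
  exact ⟨_, _, H, fun v => by
    rw [leafMap, geodesicFlow, horocycleFlow]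
    exact move_move _ _ H rfl rfl v⟩

/-- `startVec 1` points straight down from i, with backward endpoint ∞. The horocyclic flow slides
it along the line y = 1, then the geodesic flow lowers it vertically, so that x = s and y = exp
(-t). -/
theorem base_leafMap_startVec_one (p : ℝ × ℝ) :
    ((leafMap (startVec 1) p).base : ℂ) = p.1 + Complex.I * (Real.exp (-p.2) : ℝ) := by
  obtain ⟨s, t⟩ := p
  have e1 : Real.cosh (t / 2) + Real.sinh (t / 2) = Real.exp (t / 2) := Real.cosh_add_sinh _
  have e2 : Real.exp (t / 2) * (1 - Real.exp (-t)) = 2 * Real.sinh (t / 2) := by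
    rw [Real.sinh_eq, mul_sub, ← Real.exp_add]
    ring_nf
  have hden : (startVec 1).denom (1 + Complex.I * (s / 2 : ℝ)) (Complex.I * (s / 2 : ℝ)) = 1 := by
    simp only [UnitTangent.denom, dir_startVec, map_add, map_one, map_mul, Complex.conj_I,
      Complex.conj_ofReal, Circle.coe_one]
    ring
  have hb : ((horocycleFlow s (startVec 1)).base : ℂ) = Complex.I + s := by
    rw [horocycleFlow, base_move', hden]
    simp
    linear_combination -(s : ℂ) * Complex.I_sq
  have him : (horocycleFlow s (startVec 1)).base.im = 1 := by
    rw [← UpperHalfPlane.coe_im, hb]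
    simp
  have hdir : (horocycleFlow s (startVec 1)).dir = -1 := by
    rw [horocycleFlow, dir_move, hden]
    simp
  rw [leafMap, geodesicFlow, base_move', him, hb, UnitTangent.denom, hdir, Complex.conj_ofReal]
  have e3 : ((Real.cosh (t / 2) : ℝ) : ℂ) - -1 * (Real.sinh (t / 2) : ℝ) =
      (Real.exp (t / 2) : ℝ) := by
    rw [← e1]
    push_cast
    ring
  have e4 : ((Real.exp (t / 2) : ℝ) : ℂ) ≠ 0 := by
    exact_mod_cast (Real.exp_pos _).ne'
  have e5 : ((Real.exp (t / 2) : ℝ) : ℂ) * (1 - (Real.exp (-t) : ℝ)) =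
      2 * (Real.sinh (t / 2) : ℝ) := by exact_mod_cast e2
  simp only [Complex.ofReal_one] at *
  rw [e3]
  field_simp
  linear_combination (Complex.I) * e5

/-- The rotation of `ℍ` about `i` that corresponds to the rotation of the unit disc of
angle `2 arg β`. -/
def rotation (β : Circle) : Matrix.SpecialLinearGroup (Fin 2) ℝ :=
  ⟨!![(β : ℂ).re, (β : ℂ).im; -(β : ℂ).im, (β : ℂ).re], by
    have := Circle.normSq_coe β
    rw [Complex.normSq_apply] at this
    simp [Matrix.det_fin_two, this]⟩

theorem coe_rotation_smul (β : Circle) (z : ℍ) : ((rotation β • z : ℍ) : ℂ) =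
    (((β : ℂ).re : ℂ) * z + ((β : ℂ).im : ℂ)) / (-((β : ℂ).im : ℂ) * z + ((β : ℂ).re : ℂ)) := by
  rw [UpperHalfPlane.coe_specialLinearGroup_apply]
  simp [rotation]

theorem rotation_denom_ne (β : Circle) (z : ℍ) :
    -((β : ℂ).im : ℂ) * z + ((β : ℂ).re : ℂ) ≠ 0 := by
  intro h
  have h1 := congrArg Complex.re h
  have h2 := congrArg Complex.im h
  have := Circle.normSq_coe β
  rw [Complex.normSq_apply] at this
  have hz := z.im_ne_zero
  simp at h1 h2
  have h3 : (β : ℂ).im = 0 := by simpa [hz] using h2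
  simp [h3] at h1
  simp [h1, h3] at this

/-- Isometries of ℍ act on the left and commute with the flows, which act on the right. The
derivative of `rotation β` at i is β ^ 2, so it carries `startVec 1` to `startVec (β ^ 2)`. -/
theorem base_leafMap_startVec (β : Circle) (p : ℝ × ℝ) :
    (leafMap (startVec (β ^ 2)) p).base = rotation β • (leafMap (startVec 1) p).base := by
  obtain ⟨a, b, h, H⟩ := exists_leafMap_eq_move p
  have h1 := (startVec (β ^ 2)).denom_ne h
  have h2 := (startVec 1).denom_ne h
  have h3 := rotation_denom_ne β (leafMap (startVec 1) p).base
  apply UpperHalfPlane.ext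
  rw [coe_rotation_smul]
  rw [H, base_move] at h3
  rw [H, H, base_move, base_move]
  have hβ : (β : ℂ) = (β : ℂ).re + (β : ℂ).im * Complex.I := (Complex.re_add_im _).symm
  have hn : ((β : ℂ).re : ℂ) ^ 2 + ((β : ℂ).im : ℂ) ^ 2 = 1 := by
    have := Circle.normSq_coe β
    rw [Complex.normSq_apply] at this
    norm_cast
    linarith
  simp only [UnitTangent.denom, dir_startVec, base_startVec, UpperHalfPlane.coe_I, Circle.coe_pow,
    Complex.conj_I, Circle.coe_one] at *
  generalize ((β : ℂ).re : ℂ) = c at *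
  generalize ((β : ℂ).im : ℂ) = s at *
  generalize (β : ℂ) = u at *
  generalize starRingEnd ℂ a = a' at *
  have huu : u * (c - s * Complex.I) = 1 := by
    rw [hβ]
    linear_combination hn - s ^ 2 * Complex.I_sq
  have k1 : -s * ((Complex.I * a' - -Complex.I * -1 * b) / (a' - -1 * b)) + c =
      ((c - s * Complex.I) * a' + u * b) / (a' - -1 * b) := by
    rw [eq_div_iff h2, add_mul, mul_assoc, div_mul_cancel₀ _ h2, hβ]
    ring
  have k2 : c * ((Complex.I * a' - -Complex.I * -1 * b) / (a' - -1 * b)) + s =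
      Complex.I * ((c - s * Complex.I) * a' - u * b) / (a' - -1 * b) := by
    rw [eq_div_iff h2, add_mul, mul_assoc, div_mul_cancel₀ _ h2, hβ]
    linear_combination (s * a' + s * b) * Complex.I_sq
  rw [k1, div_ne_zero_iff] at h3
  rw [k1, k2, div_div_div_cancel_right₀ h2, div_eq_div_iff h1 h3.1]
  linear_combination (-2 * Complex.I * u * a' * b) * huu

/-- The Poisson kernel of `ℍ`, whose boundary is the unit circle through the Cayley transform. -/
def poisson (ξ : Circle) (z : ℍ) : ℝ :=
  4 * z.im / Complex.normSq (ξ * (z + Complex.I) - (z - Complex.I))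

theorem poisson_denom_ne (ξ : Circle) (z : ℍ) :
    (ξ : ℂ) * (z + Complex.I) - (z - Complex.I) ≠ 0 := by
  intro h
  have h1 := congrArg Complex.normSq (sub_eq_zero.1 h)
  have := z.im_pos
  rw [Complex.normSq_mul, Circle.normSq_coe] at h1
  simp [Complex.normSq_apply] at h1
  nlinarith

theorem poisson_pos (ξ : Circle) (z : ℍ) : 0 < poisson ξ z :=
  div_pos (mul_pos four_pos z.im_pos) (Complex.normSq_pos.2 (poisson_denom_ne ξ z))

theorem continuous_poisson : Continuous fun q : Circle × ℍ => poisson q.1 q.2 := by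
  have h1 : Continuous fun q : Circle × ℍ => (q.1 : ℂ) := continuous_circleCoe.comp continuous_fst
  have h2 : Continuous fun q : Circle × ℍ => (q.2 : ℂ) :=
    UpperHalfPlane.continuous_coe.comp continuous_snd
  refine Continuous.div (continuous_const.mul (UpperHalfPlane.continuous_im.comp continuous_snd))
    (Complex.continuous_normSq.comp ?_)
    fun q => (Complex.normSq_pos.2 (poisson_denom_ne q.1 q.2)).ne'
  exact (h1.mul (h2.add continuous_const)).sub (h2.sub continuous_const)

/-- Equivariance of the Poisson kernel: every boundary point is reduced to 1, that is ∞, where the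
kernel is the height. -/
theorem poisson_rotation (β : Circle) (z : ℍ) : poisson (β ^ 2) (rotation β • z) = z.im := by
  have h := rotation_denom_ne β z
  have hβ : (β : ℂ) = (β : ℂ).re + (β : ℂ).im * Complex.I := (Complex.re_add_im _).symm
  have hn : (β : ℂ).re ^ 2 + (β : ℂ).im ^ 2 = 1 := by
    have := Circle.normSq_coe β
    rw [Complex.normSq_apply] at this
    linarith
  have hn' : ((β : ℂ).re : ℂ) ^ 2 + ((β : ℂ).im : ℂ) ^ 2 = 1 := by exact_mod_cast hn
  have him : (rotation β • z).im =
      z.im / Complex.normSq (-((β : ℂ).im : ℂ) * z + ((β : ℂ).re : ℂ)) := by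
    rw [← UpperHalfPlane.coe_im, coe_rotation_smul, Complex.div_im, ← sub_div]
    congr 1
    simp
    linear_combination (z.im) * hn
  have hd : ((β ^ 2 : Circle) : ℂ) * ((rotation β • z : ℍ) + Complex.I) -
      ((rotation β • z : ℍ) - Complex.I) =
      2 * Complex.I * β / (-((β : ℂ).im : ℂ) * z + ((β : ℂ).re : ℂ)) := by
    rw [coe_rotation_smul, eq_div_iff h, Circle.coe_pow]
    generalize ((β : ℂ).re : ℂ) = c at *
    generalize ((β : ℂ).im : ℂ) = s at *
    generalize (β : ℂ) = u at *
    have e : (c * z + s) / (-s * z + c) * (-s * z + c) = c * z + s := div_mul_cancel₀ _ h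
    have huu : u * (c - s * Complex.I) = 1 := by
      rw [hβ]
      linear_combination hn' - s ^ 2 * Complex.I_sq
    have e' : (u ^ 2 * ((c * z + s) / (-s * z + c) + Complex.I) -
        ((c * z + s) / (-s * z + c) - Complex.I)) * (-s * z + c) =
        u * (u * (c - s * Complex.I)) * (z + Complex.I) - u * (z - Complex.I) := by
      linear_combination (u ^ 2 - 1) * e + (z - Complex.I) * hβ + (u ^ 2 * s - s) * Complex.I_sq
    rw [e', huu]
    ring
  rw [poisson, hd, him, Complex.normSq_div, Complex.normSq_mul, Circle.normSq_coe]
  have : Complex.normSq (-((β : ℂ).im : ℂ) * z + ((β : ℂ).re : ℂ)) ≠ 0 := by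
    simpa using h
  rw [mul_div_assoc', div_div_div_cancel_right₀ this]
  simp
  norm_num

theorem exists_sq_eq (ξ : Circle) : ∃ β : Circle, β ^ 2 = ξ := by
  refine ⟨Circle.exp (Complex.arg ξ / 2), ?_⟩
  rw [← Circle.exp_nsmul, nsmul_eq_mul, Nat.cast_ofNat, mul_div_cancel₀ _ two_ne_zero]
  exact Circle.exp_arg ξ

/-! ### The backward endpoint -/

theorem backPoint_denom_ne (v : UnitTangent) :
    (v.base : ℂ) + Complex.I + v.dir * (starRingEnd ℂ v.base + Complex.I) ≠ 0 := by
  intro h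
  have h1 := congrArg Complex.normSq (eq_neg_of_add_eq_zero_left h)
  have := v.base.im_pos
  rw [Complex.normSq_neg, Complex.normSq_mul, Complex.normSq_eq_norm_sq v.dir, norm_dir] at h1
  simp [Complex.normSq_apply] at h1
  nlinarith

/-- The backward endpoint of a unit tangent vector, as a point of the unit circle through the Cayley
transform. -/
def backPoint (v : UnitTangent) : Circle :=
  -- This is the Cayley transform of φ_v (-1) = (z + α z̄) / (1 + α), cleared of the denominator 1 +
  -- α so that the endpoint ∞ (α = -1) is included. The numerator is α times the conjugate of the
  -- denominator, hence the modulus one.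
  ⟨((v.base : ℂ) - Complex.I + v.dir * (starRingEnd ℂ v.base - Complex.I)) /
    ((v.base : ℂ) + Complex.I + v.dir * (starRingEnd ℂ v.base + Complex.I)), by
    have h : (v.base : ℂ) - Complex.I + v.dir * (starRingEnd ℂ v.base - Complex.I) =
        v.dir * starRingEnd ℂ
          ((v.base : ℂ) + Complex.I + v.dir * (starRingEnd ℂ v.base + Complex.I)) := by
      simp only [map_add, map_mul, Complex.conj_conj, Complex.conj_I]
      linear_combination (Complex.I - v.base) * v.dir_mul_conj
    refine mem_sphere_zero_iff_norm.2 ?_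
    rw [h, norm_div, norm_mul, norm_dir, RCLike.norm_conj, one_mul,
      div_self (norm_ne_zero_iff.2 (backPoint_denom_ne v))]⟩

theorem continuous_backPoint : Continuous backPoint := by
  have hz : Continuous fun v : UnitTangent => (v.base : ℂ) :=
    UpperHalfPlane.continuous_coe.comp continuous_base
  have hz' := Complex.continuous_conj.comp hz
  refine Continuous.subtype_mk (Continuous.div ?_ ?_ backPoint_denom_ne) _
  · exact (hz.sub continuous_const).add (continuous_dir.mul (hz'.sub continuous_const))
  · exact (hz.add continuous_const).add (continuous_dir.mul (hz'.add continuous_const))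

@[simp] theorem backPoint_startVec (ξ : Circle) : backPoint (startVec ξ) = ξ := by
  apply Circle.ext
  have h := backPoint_denom_ne (startVec ξ)
  simp only [backPoint]
  rw [div_eq_iff h]
  simp only [base_startVec, dir_startVec, UpperHalfPlane.coe_I, Complex.conj_I]
  ring

/-- The backward endpoint is φ_v (-1), and the matrix sends -1 to -(a - b) / conj (a - b), which is
-1 when a - b is real. -/
theorem backPoint_move {a b : ℂ} (h : Complex.normSq a - Complex.normSq b = 1) {r : ℝ}
    (hr : a - b = r) (v : UnitTangent) : backPoint (v.move a b h) = backPoint v := by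
  have hne := v.denom_ne h
  have hne' : starRingEnd ℂ (v.denom a b) ≠ 0 := by simpa using hne
  have h1 := backPoint_denom_ne v
  have h2 := backPoint_denom_ne (v.move a b h)
  have hr0 : (r : ℂ) ≠ 0 := by
    intro h0
    rw [h0, sub_eq_zero] at hr
    simp [hr] at h
  have hr' : starRingEnd ℂ a - starRingEnd ℂ b = r := by
    rw [← map_sub, hr, Complex.conj_ofReal]
  have hu := v.dir_mul_conj
  have e1 : ((v.move a b h).base : ℂ) + (v.move a b h).dir * starRingEnd ℂ (v.move a b h).base =
      r * ((v.base : ℂ) + v.dir * starRingEnd ℂ v.base) / v.denom a b := by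
    rw [base_move, dir_move, map_div₀, eq_div_iff hne]
    field_simp
    simp only [map_sub, map_mul, Complex.conj_conj]
    linear_combination (v.base : ℂ) * hr' + v.dir * starRingEnd ℂ v.base * hr -
      v.base * starRingEnd ℂ b * hu
  have e2 : 1 + (v.move a b h).dir = r * (1 + v.dir) / v.denom a b := by
    rw [dir_move, eq_div_iff hne, add_mul, div_mul_cancel₀ _ hne]
    simp only [UnitTangent.denom, map_sub, map_mul, Complex.conj_conj]
    linear_combination hr' + v.dir * hr - starRingEnd ℂ b * hu
  apply Circle.ext
  simp only [backPoint]
  rw [div_eq_div_iff h2 h1]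
  linear_combination (2 * Complex.I * (1 + v.dir)) * e1 -
    (2 * Complex.I * ((v.base : ℂ) + v.dir * starRingEnd ℂ v.base)) * e2

theorem backPoint_geodesicFlow (t : ℝ) (v : UnitTangent) :
    backPoint (geodesicFlow t v) = backPoint v :=
  backPoint_move (r := Real.cosh (t / 2) - Real.sinh (t / 2)) _ (by push_cast; rfl) v

theorem backPoint_horocycleFlow (s : ℝ) (v : UnitTangent) :
    backPoint (horocycleFlow s v) = backPoint v :=
  backPoint_move (r := 1) _ (by push_cast; ring) v

theorem backPoint_leafMap (v : UnitTangent) (p : ℝ × ℝ) :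
    backPoint (leafMap v p) = backPoint v := by
  rw [leafMap, backPoint_geodesicFlow, backPoint_horocycleFlow]

/-- A unit tangent vector is determined by its base point and its backward endpoint. -/
theorem eq_of_base_of_backPoint {v w : UnitTangent} (h : v.base = w.base)
    (h' : backPoint v = backPoint w) : v = w := by
  have h1 := backPoint_denom_ne v
  have h2 := backPoint_denom_ne w
  have h3 := congrArg (fun ξ : Circle => (ξ : ℂ)) h'
  simp only [backPoint] at h3
  rw [div_eq_div_iff h1 h2, ← h, v.base_conj] at h3
  have him : (v.base.im : ℂ) ≠ 0 := v.im_ne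
  have hd : v.dir = w.dir := by
    have : (v.base.im : ℂ) * (v.dir - w.dir) = 0 := by
      linear_combination (1 / 4) * h3 +
        (v.base.im : ℂ) * (v.dir - w.dir) * Complex.I_sq
    exact sub_eq_zero.1 ((mul_eq_zero.1 this).resolve_left him)
  refine ext' (by rw [h]) ?_
  rw [v.vec_eq, w.vec_eq, hd, h]

/-- After a rotation to ξ = 1 the kernel is the height exp (-t). This identifies the Jacobians that
appear in the classification with values of the Poisson kernel. -/
theorem poisson_base_leafMap (ξ : Circle) (p : ℝ × ℝ) :
    poisson ξ (leafMap (startVec ξ) p).base = Real.exp (-p.2) := by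
  obtain ⟨β, rfl⟩ := exists_sq_eq ξ
  rw [base_leafMap_startVec, poisson_rotation, ← UpperHalfPlane.coe_im, base_leafMap_startVec_one]
  simp [-Complex.ofReal_exp]

/-- Every unit tangent vector lies on the leaf of its backward endpoint. -/
theorem exists_eq_leafMap (v : UnitTangent) : ∃ p, v = leafMap (startVec (backPoint v)) p := by
  obtain ⟨β, hβ⟩ := exists_sq_eq (backPoint v)
  set z : ℍ := (rotation β)⁻¹ • v.base
  refine ⟨(z.re, -Real.log z.im), eq_of_base_of_backPoint ?_ ?_⟩
  · rw [← hβ, base_leafMap_startVec, eq_comm, ← eq_inv_smul_iff]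
    apply UpperHalfPlane.ext
    rw [base_leafMap_startVec_one, neg_neg, Real.exp_log z.im_pos]
    change _ = (z : ℂ)
    apply Complex.ext <;> simp
  · rw [backPoint_leafMap, backPoint_startVec]

/-! ### Hyperbolic area in horocyclic coordinates -/

theorem lintegral_Ioi_div_eq (F : ℝ → ENNReal) :
    ∫⁻ y in Set.Ioi (0 : ℝ), F y * ENNReal.ofReal (1 / y) = ∫⁻ t : ℝ, F (Real.exp (-t)) := by
  have hd : ∀ t ∈ (Set.univ : Set ℝ),
      HasDerivWithinAt (fun t => Real.exp (-t)) (-Real.exp (-t)) Set.univ t := fun t _ => by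
    have := ((hasDerivAt_id t).neg.exp).hasDerivWithinAt (s := Set.univ)
    simpa using this
  have hi : Set.InjOn (fun t : ℝ => Real.exp (-t)) Set.univ := fun a _ b _ h => by
    simpa using h
  have himg : (fun t : ℝ => Real.exp (-t)) '' Set.univ = Set.Ioi 0 := by
    rw [Set.image_univ]
    ext y
    constructor
    · rintro ⟨t, rfl⟩
      exact Real.exp_pos _
    · intro hy
      exact ⟨-Real.log y, by simp [Real.exp_log hy]⟩
  have := lintegral_image_eq_lintegral_abs_deriv_mul MeasurableSet.univ hd hi
    fun y => F y * ENNReal.ofReal (1 / y)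
  rw [himg, setLIntegral_univ] at this
  rw [this]
  refine lintegral_congr fun t => ?_
  rw [abs_neg, abs_of_pos (Real.exp_pos _), mul_comm (F _), ← mul_assoc,
    ← ENNReal.ofReal_mul (Real.exp_pos _).le, mul_one_div_cancel (Real.exp_pos _).ne',
    ENNReal.ofReal_one, one_mul]

/-- The weight y turns the area y⁻² dx dy into dx dy / y, which is ds dt under x = s, y = exp (-t).
-/
theorem lintegral_upperHalfPlane {f : ℍ → ENNReal} (hf : Measurable f) :
    ∫⁻ z : ℍ, f z * ENNReal.ofReal z.im =
      ∫⁻ p : ℝ × ℝ, f (leafMap (startVec 1) p).base := by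
  have he := UpperHalfPlane.measurableEmbedding_coe
  -- Extending by zero to ℂ allows Lebesgue measure and Fubini in x and y; the value below the real
  -- axis plays no role.
  set G : ℂ → ENNReal := Function.extend UpperHalfPlane.coe f 0
  have hG : Measurable G := he.measurable_extend hf measurable_const
  have hGf : ∀ z : ℍ, G z = f z := fun z => he.injective.extend_apply f 0 z
  have hG' : Measurable fun z : ℂ => G z * ENNReal.ofReal (1 / z.im) := by fun_prop
  have hw : Measurable fun z : ℍ => (((1 / NNReal.mk z.im z.im_pos.le : NNReal) ^ 2 : NNReal) :
      ENNReal) := by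
    have : Measurable fun z : ℍ => NNReal.mk z.im z.im_pos.le :=
      UpperHalfPlane.continuous_im.measurable.subtype_mk
    fun_prop
  have h1 : ∫⁻ z : ℍ, f z * ENNReal.ofReal z.im =
      ∫⁻ z in {z : ℂ | 0 < z.im}, G z * ENNReal.ofReal (1 / z.im) := by
    have hr : Set.range UpperHalfPlane.coe = {z : ℂ | 0 < z.im} := UpperHalfPlane.range_coe
    rw [← hr, ← he.map_comap, he.lintegral_map, UpperHalfPlane.volume_def,
      lintegral_withDensity_eq_lintegral_mul _ hw (by fun_prop)]
    · refine lintegral_congr fun z => ?_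
      have hz := z.im_pos
      rw [hGf, Pi.mul_apply, mul_comm, mul_assoc, ← ENNReal.ofReal_coe_nnreal,
        ← ENNReal.ofReal_mul hz.le]
      congr 2
      simp
      field_simp
  rw [h1, ← (Complex.volume_preserving_equiv_real_prod.symm).setLIntegral_comp_preimage
    (measurableSet_lt measurable_const Complex.measurable_im) hG']
  have hs : Complex.measurableEquivRealProd.symm ⁻¹' {z : ℂ | 0 < z.im} =
      Set.univ ×ˢ Set.Ioi (0 : ℝ) := by
    ext p
    simp
  rw [hs, Measure.volume_eq_prod, setLIntegral_prod, setLIntegral_univ, lintegral_prod]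
  · refine lintegral_congr fun x => ?_
    have := lintegral_Ioi_div_eq fun y => G (x + Complex.I * y)
    simp only [← hGf, base_leafMap_startVec_one]
    rw [← this]
    refine lintegral_congr fun y => ?_
    have hxy : Complex.measurableEquivRealProd.symm (x, y) = x + Complex.I * y := by
      apply Complex.ext <;> simp
    rw [hxy]
    simp
  · exact (hf.comp (continuous_base.comp (continuous_const.leafMap continuous_id)).measurable).aemeasurable
  · exact (hG'.comp (MeasurableEquiv.measurable _)).aemeasurable

theorem measurePreserving_rotation (β : Circle) :
    MeasurePreserving (fun z : ℍ => rotation β • z) volume volume := by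
  exact measurePreserving_smul (rotation β : GL (Fin 2) ℝ) volume

theorem continuous_poisson_right (ξ : Circle) : Continuous (poisson ξ) :=
  continuous_poisson.comp (continuous_const.prodMk continuous_id)

theorem lintegral_base_leafMap {f : ℍ → ENNReal} (hf : Measurable f) (ξ : Circle) :
    ∫⁻ p : ℝ × ℝ, f (leafMap (startVec ξ) p).base =
      ∫⁻ z : ℍ, f z * ENNReal.ofReal (poisson ξ z) := by
  obtain ⟨β, rfl⟩ := exists_sq_eq ξ
  have h := measurePreserving_rotation β
  rw [← h.lintegral_comp (f := fun z => f z * ENNReal.ofReal (poisson (β ^ 2) z))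
    (hf.mul (continuous_poisson_right _).measurable.ennreal_ofReal)]
  simp only [poisson_rotation, base_leafMap_startVec]
  exact (lintegral_upperHalfPlane (hf.comp h.measurable)).symm

/-! ### The invariant measures built from measures on the circle -/

instance : MeasurableSpace Circle := borel Circle

instance : BorelSpace Circle := ⟨rfl⟩

theorem geodesicFlow_leafMap (r : ℝ) (v : UnitTangent) (p : ℝ × ℝ) :
    geodesicFlow r (leafMap v p) = leafMap v (p.1, p.2 + r) := by
  rw [leafMap, leafMap, geodesicFlow_add]

theorem horocycleFlow_geodesicFlow (s t : ℝ) (v : UnitTangent) :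
    horocycleFlow s (geodesicFlow t v) = geodesicFlow t (horocycleFlow (Real.exp (-t) * s) v) := by
  rw [geodesicFlow_horocycleFlow, ← mul_assoc, ← Real.exp_add]
  simp

/-- Moving the horocyclic flow past geodesic time t multiplies its time by exp (-t). Thus one flow
translates (s, t) and the other shears it; both have Jacobian one, so ds dt is invariant. -/
theorem horocycleFlow_leafMap (σ : ℝ) (v : UnitTangent) (p : ℝ × ℝ) :
    horocycleFlow σ (leafMap v p) = leafMap v (p.1 + Real.exp (-p.2) * σ, p.2) := by
  rw [leafMap, leafMap, horocycleFlow_geodesicFlow, horocycleFlow_add]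

theorem leafMap_leafMap (v : UnitTangent) (p q : ℝ × ℝ) :
    leafMap (leafMap v q) p = leafMap v (q.1 + Real.exp (-q.2) * p.1, q.2 + p.2) := by
  rw [leafMap, horocycleFlow_leafMap, geodesicFlow_leafMap]

theorem measurePreserving_add_snd (r : ℝ) :
    MeasurePreserving (fun p : ℝ × ℝ => (p.1, p.2 + r)) :=
  (MeasurePreserving.id volume).prod (measurePreserving_add_right volume r)

theorem measurePreserving_shear (σ : ℝ) :
    MeasurePreserving (fun p : ℝ × ℝ => (p.1 + Real.exp (-p.2) * σ, p.2)) := by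
  have h : MeasurePreserving (fun p : ℝ × ℝ => (p.1, p.2 + Real.exp (-p.1) * σ)) :=
    (MeasurePreserving.id volume).skew_product (g := fun t s => s + Real.exp (-t) * σ)
      (by fun_prop) (.of_forall fun t => (measurePreserving_add_right volume _).map_eq)
  exact (Measure.measurePreserving_swap.comp h).comp Measure.measurePreserving_swap

/-- The map that attaches to a boundary point and to horocyclic coordinates a vector on the
corresponding leaf. -/
def horoChart (q : Circle × ℝ × ℝ) : UnitTangent := leafMap (startVec q.1) q.2

theorem continuous_horoChart : Continuous horoChart :=
  (continuous_startVec.comp continuous_fst).leafMap continuous_snd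

/-- The jointly invariant measure on `T¹ℍ` with a given transverse measure on the circle. -/
def horoMeasure (ν : Measure Circle) : Measure UnitTangent :=
  (ν.prod volume).map horoChart

theorem lintegral_horoMeasure (ν : Measure Circle) [SFinite ν] {f : UnitTangent → ENNReal}
    (hf : Measurable f) : ∫⁻ v, f v ∂(horoMeasure ν) =
      ∫⁻ ξ, (∫⁻ p : ℝ × ℝ, f (leafMap (startVec ξ) p)) ∂ν := by
  rw [horoMeasure, lintegral_map hf continuous_horoChart.measurable,
    lintegral_prod (fun q => f (horoChart q))
      (hf.comp continuous_horoChart.measurable).aemeasurable]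
  rfl

theorem isJointlyInvariant_horoMeasure (ν : Measure Circle) [SFinite ν] :
    IsJointlyInvariant (horoMeasure ν) := by
  have key : ∀ (T : ℝ × ℝ → ℝ × ℝ) (φ : UnitTangent → UnitTangent), MeasurePreserving T →
      Continuous φ → (∀ ξ p, φ (leafMap (startVec ξ) p) = leafMap (startVec ξ) (T p)) →
      MeasurePreserving φ (horoMeasure ν) (horoMeasure ν) := by
    intro T φ hT hφ h
    refine ⟨hφ.measurable, ?_⟩
    have h1 := ((MeasurePreserving.id ν).prod hT)
    have h2 : φ ∘ horoChart = horoChart ∘ Prod.map id T := by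
      funext q
      exact h q.1 q.2
    rw [horoMeasure, Measure.map_map hφ.measurable continuous_horoChart.measurable, h2,
      ← Measure.map_map continuous_horoChart.measurable h1.measurable]
    exact congrArg _ h1.map_eq
  exact ⟨fun t => key _ _ (measurePreserving_add_snd t)
      (continuous_const.geodesicFlow continuous_id) fun _ _ => geodesicFlow_leafMap _ _ _,
    fun s => key _ _ (measurePreserving_shear s)
      (continuous_const.horocycleFlow continuous_id) fun _ _ => horocycleFlow_leafMap _ _ _⟩

/-- The Poisson integral of a measure on the circle. -/
def poissonLIntegral (ν : Measure Circle) (z : ℍ) : ENNReal :=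
  ∫⁻ ξ, ENNReal.ofReal (poisson ξ z) ∂ν

theorem measurable_poissonLIntegral (ν : Measure Circle) [SFinite ν] :
    Measurable (poissonLIntegral ν) :=
  Measurable.lintegral_prod_left' continuous_poisson.measurable.ennreal_ofReal

theorem map_base_horoMeasure (ν : Measure Circle) [SFinite ν] :
    (horoMeasure ν).map UnitTangent.base =
      (volume : Measure ℍ).withDensity (poissonLIntegral ν) := by
  refine Measure.ext_of_lintegral _ fun f hf => ?_
  rw [lintegral_map hf continuous_base.measurable,
    lintegral_horoMeasure ν (f := fun v => f v.base) (hf.comp continuous_base.measurable),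
    lintegral_withDensity_eq_lintegral_mul _ (measurable_poissonLIntegral ν) hf]
  have hm : Measurable fun q : Circle × ℍ => f q.2 * ENNReal.ofReal (poisson q.1 q.2) :=
    (hf.comp measurable_snd).mul continuous_poisson.measurable.ennreal_ofReal
  simp only [lintegral_base_leafMap hf]
  rw [lintegral_lintegral_swap hm.aemeasurable]
  refine lintegral_congr fun z => ?_
  have hz : Continuous fun ξ => poisson ξ z :=
    continuous_poisson.comp (continuous_id.prodMk continuous_const)
  rw [lintegral_const_mul _ hz.measurable.ennreal_ofReal, Pi.mul_apply, mul_comm]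
  rfl

/-! ### Compactness, local finiteness and positivity on open sets -/

theorem isCompact_preimage_base {K : Set ℍ} (hK : IsCompact K) :
    IsCompact (UnitTangent.base ⁻¹' K) := by
  obtain ⟨M, hM⟩ := (hK.image UpperHalfPlane.continuous_im).bddAbove
  have hc : Topology.IsClosedEmbedding (Subtype.val : UnitTangent → ℍ × ℂ) := by
    refine IsClosed.isClosedEmbedding_subtypeVal (isClosed_eq ?_ ?_)
    · exact continuous_snd.norm
    · exact UpperHalfPlane.continuous_im.comp continuous_fst
  refine IsCompact.of_isClosed_subset
    (hc.isCompact_preimage (hK.prod (isCompact_closedBall (0 : ℂ) M)))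
    (hK.isClosed.preimage continuous_base) fun v hv => ⟨hv, ?_⟩
  rw [mem_closedBall_zero_iff]
  exact v.norm_vec.le.trans (hM ⟨_, hv, rfl⟩)

theorem exists_poisson_bounds {K : Set ℍ} (hK : IsCompact K) :
    ∃ M : ℝ, ∀ ξ, ∀ z ∈ K, poisson ξ z ≤ M ∧ 1 / poisson ξ z ≤ M := by
  obtain ⟨M₁, h₁⟩ := ((isCompact_univ.prod hK).image continuous_poisson).bddAbove
  obtain ⟨M₂, h₂⟩ := ((isCompact_univ.prod hK).image
    (continuous_const.div continuous_poisson fun q => (poisson_pos q.1 q.2).ne' :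
      Continuous fun q : Circle × ℍ => 1 / poisson q.1 q.2)).bddAbove
  exact ⟨max M₁ M₂, fun ξ z hz =>
    ⟨(h₁ ⟨(ξ, z), ⟨Set.mem_univ _, hz⟩, rfl⟩).trans (le_max_left _ _),
      (h₂ ⟨(ξ, z), ⟨Set.mem_univ _, hz⟩, rfl⟩).trans (le_max_right _ _)⟩⟩

theorem isLocallyFiniteMeasure_horoMeasure (ν : Measure Circle) [IsFiniteMeasure ν] :
    IsLocallyFiniteMeasure (horoMeasure ν) := by
  refine ⟨fun v => ?_⟩
  obtain ⟨K, hK, hv⟩ := exists_compact_mem_nhds v.base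
  refine ⟨UnitTangent.base ⁻¹' K, continuous_base.continuousAt.preimage_mem_nhds hv, ?_⟩
  obtain ⟨M, hM⟩ := exists_poisson_bounds hK
  rw [← Measure.map_apply continuous_base.measurable hK.measurableSet, map_base_horoMeasure,
    withDensity_apply _ hK.measurableSet]
  calc ∫⁻ z in K, poissonLIntegral ν z ≤ ∫⁻ _ in K, ENNReal.ofReal M * ν Set.univ := by
        refine setLIntegral_mono' hK.measurableSet fun z hz => ?_
        rw [← lintegral_const]
        exact lintegral_mono fun ξ => ENNReal.ofReal_le_ofReal (hM ξ z hz).1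
    _ < ⊤ := by
        rw [setLIntegral_const]
        exact ENNReal.mul_lt_top (ENNReal.mul_lt_top ENNReal.ofReal_lt_top (measure_lt_top _ _))
          hK.measure_lt_top

/-- Needed to normalize the area of a ball and to pass from equality almost everywhere of continuous
densities to equality everywhere. -/
instance : (volume : Measure ℍ).IsOpenPosMeasure := by
  refine ⟨fun U hU hne h0 => ?_⟩
  have hU' : IsOpen (UpperHalfPlane.coe '' U) := UpperHalfPlane.isOpenEmbedding_coe.isOpenMap U hU
  rw [UpperHalfPlane.volume_eq_lintegral, setLIntegral_eq_zero_iff hU'.measurableSet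
    (by fun_prop)] at h0
  refine hU'.measure_ne_zero volume (hne.image _) (measure_eq_zero_iff_ae_notMem.2 ?_)
  filter_upwards [h0] with z hz hzU
  obtain ⟨w, -, rfl⟩ := id hzU
  simpa [w.im_ne_zero] using hz hzU

/-! ### Classification of the jointly invariant measures -/

theorem lintegral_comp_affine {F : ℝ × ℝ → ENNReal} (hF : Measurable F) (c σ r : ℝ) :
    ∫⁻ p : ℝ × ℝ, F (σ + Real.exp c * p.1, r + p.2) =
      ENNReal.ofReal (Real.exp (-c)) * ∫⁻ p, F p := by
  have hc := Real.exp_pos c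
  have h1 : MeasurePreserving (fun p : ℝ × ℝ => (σ + p.1, r + p.2)) :=
    measurePreserving_add_left volume ((σ, r) : ℝ × ℝ)
  have h2 : (volume : Measure (ℝ × ℝ)).map (fun p => (Real.exp c * p.1, p.2)) =
      ENNReal.ofReal (Real.exp (-c)) • volume := by
    have h := Measure.map_prod_map (volume : Measure ℝ) (volume : Measure ℝ)
      (measurable_const_mul (Real.exp c)) measurable_id
    rw [Real.map_volume_mul_left hc.ne', Measure.map_id, Measure.prod_smul_left] at h
    rw [Measure.volume_eq_prod, Real.exp_neg, ← abs_of_pos (inv_pos.2 hc), h]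
    rfl
  calc ∫⁻ p : ℝ × ℝ, F (σ + Real.exp c * p.1, r + p.2)
      = ∫⁻ p, F (σ + p.1, r + p.2) ∂((volume : Measure (ℝ × ℝ)).map
          (fun p => (Real.exp c * p.1, p.2))) := by
        rw [lintegral_map (by fun_prop) (by fun_prop)]
    _ = _ := by
        rw [h2, lintegral_smul_measure, smul_eq_mul, h1.lintegral_comp hF]

/-- The leaf measures of the vectors of one leaf are proportional. -/
theorem lintegral_leafMap {f : UnitTangent → ENNReal} (hf : Measurable f) (v : UnitTangent) :
    ∫⁻ p, f (leafMap v p) = ENNReal.ofReal (1 / poisson (backPoint v) v.base) *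
      ∫⁻ p, f (leafMap (startVec (backPoint v)) p) := by
  obtain ⟨⟨σ, r⟩, hv⟩ := exists_eq_leafMap v
  -- By `leafMap_leafMap`, moving the origin of the leaf to v is the affine map (s, t) ↦ (σ + exp
  -- (-r) s, r + t). It produces the factor exp r, which is the inverse of the Poisson kernel at v.
  have h := lintegral_comp_affine (F := fun p => f (leafMap (startVec (backPoint v)) p))
    (hf.comp (continuous_const.leafMap continuous_id).measurable) (-r) σ r
  have hp : 1 / poisson (backPoint v) v.base = Real.exp (- -r) := by
    conv_lhs => rw [hv, backPoint_leafMap, backPoint_startVec, poisson_base_leafMap]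
    rw [one_div, ← Real.exp_neg]
  rw [hp, ← h]
  refine lintegral_congr fun p => ?_
  conv_lhs => rw [hv, leafMap_leafMap]

theorem horocycleFlow_geodesicFlow_neg (v : UnitTangent) (p : ℝ × ℝ) :
    horocycleFlow (-p.1) (geodesicFlow (-p.2) v) = leafMap v (-(Real.exp p.2 * p.1), -p.2) := by
  rw [horocycleFlow_geodesicFlow, leafMap, neg_neg, mul_neg]

theorem lintegral_exp_mul_base_leafMap_startVec {κ : ℍ → ENNReal} (hκ : Measurable κ)
    (ξ : Circle) :
    ∫⁻ p : ℝ × ℝ, ENNReal.ofReal (Real.exp p.2) * κ (leafMap (startVec ξ) p).base =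
      ∫⁻ z, κ z := by
  have hP := continuous_poisson_right ξ
  have h := lintegral_base_leafMap
    (f := fun z => ENNReal.ofReal (1 / poisson ξ z) * κ z) (by fun_prop) ξ
  simp only [poisson_base_leafMap, one_div, ← Real.exp_neg, neg_neg] at h
  rw [h]
  refine lintegral_congr fun z => ?_
  have hz := poisson_pos ξ z
  rw [mul_comm, ← mul_assoc, ← ENNReal.ofReal_mul hz.le, mul_inv_cancel₀ hz.ne',
    ENNReal.ofReal_one, one_mul]

/-- The affine group is not unimodular: inversion turns ds dt into exp t ds dt, its other Haar
measure. Since exp (-t) is the Poisson kernel at the reference vector of a leaf, this weighted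
measure projects to the plain area, and it does not depend on v. -/
theorem lintegral_base_horocycleFlow_geodesicFlow {κ : ℍ → ENNReal} (hκ : Measurable κ)
    (v : UnitTangent) :
    ∫⁻ p : ℝ × ℝ, κ (horocycleFlow (-p.1) (geodesicFlow (-p.2) v)).base = ∫⁻ z, κ z := by
  obtain ⟨⟨σ, r⟩, hv⟩ := exists_eq_leafMap v
  have hb (w : UnitTangent) : Measurable fun p => κ (leafMap w p).base :=
    hκ.comp (continuous_base.comp (continuous_const.leafMap continuous_id)).measurable
  have h1 : ∫⁻ p : ℝ × ℝ, κ (horocycleFlow (-p.1) (geodesicFlow (-p.2) v)).base =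
      ∫⁻ p : ℝ × ℝ, ENNReal.ofReal (Real.exp p.2) * κ (leafMap v p).base := by
    simp only [horocycleFlow_geodesicFlow_neg]
    have hm : Measurable fun p : ℝ × ℝ => κ (leafMap v (-(Real.exp p.2 * p.1), -p.2)).base :=
      (hb v).comp (by fun_prop : Measurable fun p : ℝ × ℝ => (-(Real.exp p.2 * p.1), -p.2))
    have hm' : Measurable fun p : ℝ × ℝ =>
        ENNReal.ofReal (Real.exp p.2) * κ (leafMap v p).base :=
      (by fun_prop : Measurable fun p : ℝ × ℝ => ENNReal.ofReal (Real.exp p.2)).mul (hb v)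
    rw [Measure.volume_eq_prod, lintegral_prod_symm _ hm.aemeasurable,
      lintegral_prod_symm _ hm'.aemeasurable, ← lintegral_neg_eq_self]
    refine lintegral_congr fun t => ?_
    have ha : -Real.exp (-t) ≠ 0 := neg_ne_zero.2 (Real.exp_pos _).ne'
    have hs : Measurable fun s => κ (leafMap v (s, t)).base :=
      (hb v).comp measurable_prodMk_right
    have h := lintegral_map (μ := volume) hs (measurable_const_mul (-Real.exp (-t)))
    rw [Real.map_volume_mul_left ha, lintegral_smul_measure, inv_neg, abs_neg,
      abs_of_pos (inv_pos.2 (Real.exp_pos _)), ← Real.exp_neg, neg_neg, smul_eq_mul] at h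
    dsimp only
    rw [lintegral_const_mul _ hs, h]
    simp only [neg_mul, neg_neg]
  -- Change of origin in the leaf: the Jacobian exp r cancels against the shift of t by r in the
  -- weight.
  have h2 : ∫⁻ p : ℝ × ℝ, ENNReal.ofReal (Real.exp p.2) * κ (leafMap v p).base =
      ∫⁻ p : ℝ × ℝ, ENNReal.ofReal (Real.exp p.2) *
        κ (leafMap (startVec (backPoint v)) p).base := by
    have h := lintegral_comp_affine (F := fun p => ENNReal.ofReal (Real.exp p.2) *
      κ (leafMap (startVec (backPoint v)) p).base)
      ((by fun_prop : Measurable fun p : ℝ × ℝ => ENNReal.ofReal (Real.exp p.2)).mul (hb _))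
      (-r) σ r
    have hr : ENNReal.ofReal (Real.exp (- -r)) ≠ 0 := by simp [Real.exp_pos]
    rw [← (ENNReal.mul_right_inj hr ENNReal.ofReal_ne_top), ← h,
      ← lintegral_const_mul _ (by
        exact (by fun_prop : Measurable fun p : ℝ × ℝ =>
          ENNReal.ofReal (Real.exp p.2)).mul (hb _))]
    refine lintegral_congr fun p => ?_
    conv_lhs => rw [hv, leafMap_leafMap]
    rw [← mul_assoc, ← ENNReal.ofReal_mul (Real.exp_pos _).le, ← Real.exp_add, neg_neg]
  rw [h1, h2, lintegral_exp_mul_base_leafMap_startVec hκ]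

theorem IsJointlyInvariant.measurePreserving_leafMap {μ : Measure UnitTangent}
    (h : IsJointlyInvariant μ) (p : ℝ × ℝ) : MeasurePreserving (fun v => leafMap v p) μ μ :=
  (h.geodesic p.2).comp (h.horocycle p.1)

/-- The averaging identity behind the classification. The integral of κ is written as an integral
over inverse group elements applied to v; after Tonelli, invariance of μ replaces v by `leafMap v
p`, which moves the group action from κ to f. -/
theorem IsJointlyInvariant.lintegral_mul {μ : Measure UnitTangent} [SFinite μ]
    (h : IsJointlyInvariant μ) {f : UnitTangent → ENNReal} (hf : Measurable f)
    {κ : ℍ → ENNReal} (hκ : Measurable κ) :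
    (∫⁻ v, f v ∂μ) * ∫⁻ z, κ z = ∫⁻ v, κ v.base * ∫⁻ p, f (leafMap v p) ∂volume ∂μ := by
  have hb : Measurable fun v : UnitTangent => κ v.base := hκ.comp continuous_base.measurable
  have hA : Continuous fun q : UnitTangent × ℝ × ℝ =>
      horocycleFlow (-q.2.1) (geodesicFlow (-q.2.2) q.1) :=
    (by fun_prop : Continuous fun q : UnitTangent × ℝ × ℝ => -q.2.1).horocycleFlow
      ((by fun_prop : Continuous fun q : UnitTangent × ℝ × ℝ => -q.2.2).geodesicFlow
        continuous_fst)
  have hL : Continuous fun q : UnitTangent × ℝ × ℝ => leafMap q.1 q.2 :=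
    continuous_fst.leafMap continuous_snd
  have hinv (v : UnitTangent) (p : ℝ × ℝ) :
      horocycleFlow (-p.1) (geodesicFlow (-p.2) (leafMap v p)) = v := by
    rw [leafMap, ← geodesicFlow_add, add_neg_cancel, geodesicFlow_zero, ← horocycleFlow_add,
      add_neg_cancel, horocycleFlow_zero]
  calc (∫⁻ v, f v ∂μ) * ∫⁻ z, κ z
      = ∫⁻ v, ∫⁻ p : ℝ × ℝ, f v *
          κ (horocycleFlow (-p.1) (geodesicFlow (-p.2) v)).base ∂volume ∂μ := by
        rw [← lintegral_mul_const _ hf]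
        refine lintegral_congr fun v => ?_
        have hm : Measurable fun p : ℝ × ℝ =>
            κ (horocycleFlow (-p.1) (geodesicFlow (-p.2) v)).base :=
          hb.comp (hA.comp (continuous_const.prodMk continuous_id)).measurable
        rw [lintegral_const_mul _ hm, lintegral_base_horocycleFlow_geodesicFlow hκ]
    _ = ∫⁻ p : ℝ × ℝ, ∫⁻ v, f v *
          κ (horocycleFlow (-p.1) (geodesicFlow (-p.2) v)).base ∂μ :=
        lintegral_lintegral_swap
          ((hf.comp measurable_fst).mul (hb.comp hA.measurable)).aemeasurable
    _ = ∫⁻ p : ℝ × ℝ, ∫⁻ v, κ v.base * f (leafMap v p) ∂μ := by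
        refine lintegral_congr fun p => ?_
        have hm : Measurable fun v =>
            f v * κ (horocycleFlow (-p.1) (geodesicFlow (-p.2) v)).base :=
          hf.mul (hb.comp (hA.comp (continuous_id.prodMk continuous_const)).measurable)
        rw [← (h.measurePreserving_leafMap p).lintegral_comp hm]
        refine lintegral_congr fun v => ?_
        rw [hinv, mul_comm]
    _ = ∫⁻ v, ∫⁻ p, κ v.base * f (leafMap v p) ∂volume ∂μ :=
        (lintegral_lintegral_swap
          ((hb.comp measurable_fst).mul (hf.comp hL.measurable)).aemeasurable).symm
    _ = _ := by
        refine lintegral_congr fun v => ?_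
        have hm : Measurable fun p => f (leafMap v p) :=
          hf.comp (continuous_const.leafMap continuous_id).measurable
        rw [lintegral_const_mul _ hm]

/-- Every locally finite jointly invariant measure is a union of leaf measures. -/
theorem IsJointlyInvariant.exists_eq_horoMeasure {μ : Measure UnitTangent}
    [IsLocallyFiniteMeasure μ] (h : IsJointlyInvariant μ) :
    ∃ ν : Measure Circle, IsFiniteMeasure ν ∧ μ = horoMeasure ν := by
  set K : Set ℍ := Metric.closedBall UpperHalfPlane.I 1
  have hK : IsCompact K := isCompact_closedBall _ _
  set C := (volume : Measure ℍ) K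
  have hC0 : C ≠ 0 := (Metric.measure_closedBall_pos _ _ one_pos).ne'
  have hCtop : C ≠ ⊤ := hK.measure_lt_top.ne
  obtain ⟨M, hM⟩ := exists_poisson_bounds hK
  -- A cutoff of total mass one and compact support: it makes the averaging identity compute the
  -- integral of f and keeps the transverse measure finite.
  set κ : ℍ → ENNReal := K.indicator fun _ => C⁻¹ with hκdef
  have hκ : Measurable κ := measurable_const.indicator hK.measurableSet
  have hκ1 : ∫⁻ z, κ z = 1 := by
    rw [lintegral_indicator_const hK.measurableSet, ENNReal.inv_mul_cancel hC0 hCtop]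
  have hP : Continuous fun v : UnitTangent => 1 / poisson (backPoint v) v.base :=
    continuous_const.div (continuous_poisson.comp (continuous_backPoint.prodMk continuous_base))
      fun v => (poisson_pos _ _).ne'
  set w : UnitTangent → ENNReal := fun v =>
    κ v.base * ENNReal.ofReal (1 / poisson (backPoint v) v.base) with hwdef
  have hw : Measurable w := (hκ.comp continuous_base.measurable).mul hP.measurable.ennreal_ofReal
  have hfin : ∫⁻ v, w v ∂μ < ⊤ := by
    have hb := isCompact_preimage_base hK
    calc ∫⁻ v, w v ∂μ ≤ ∫⁻ v, (UnitTangent.base ⁻¹' K).indicator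
          (fun _ => C⁻¹ * ENNReal.ofReal M) v ∂μ := by
          refine lintegral_mono fun v => ?_
          by_cases hv : v.base ∈ K
          · rw [Set.indicator_of_mem (show v ∈ UnitTangent.base ⁻¹' K from hv), hwdef]
            simp only [hκdef, Set.indicator_of_mem hv]
            gcongr
            exact (hM _ _ hv).2
          · simp [hwdef, hκdef, hv]
      _ = C⁻¹ * ENNReal.ofReal M * μ (UnitTangent.base ⁻¹' K) :=
          lintegral_indicator_const hb.measurableSet _
      _ < ⊤ := ENNReal.mul_lt_top (ENNReal.mul_lt_top (ENNReal.inv_lt_top.2 hC0.bot_lt)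
          ENNReal.ofReal_lt_top) hb.measure_lt_top
  have hwfin : IsFiniteMeasure (μ.withDensity w) := isFiniteMeasure_withDensity hfin.ne
  -- The averaging identity writes μ as a superposition of leaf integrals starting at v.
  -- `lintegral_leafMap` moves each origin to `startVec (backPoint v)` at the cost of the factor 1 /
  -- P in w, so only the law of `backPoint` under w μ matters.
  refine ⟨(μ.withDensity w).map backPoint, inferInstance, ?_⟩
  refine Measure.ext_of_lintegral _ fun f hf => ?_
  have hg : Measurable fun ξ => ∫⁻ p, f (leafMap (startVec ξ) p) :=
    Measurable.lintegral_prod_right' (f := fun q => f (horoChart q))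
      (hf.comp continuous_horoChart.measurable)
  have hg' : Measurable fun v => ∫⁻ p, f (leafMap (startVec (backPoint v)) p) :=
    hg.comp continuous_backPoint.measurable
  rw [lintegral_horoMeasure _ hf, lintegral_map hg continuous_backPoint.measurable,
    lintegral_withDensity_eq_lintegral_mul _ hw hg',
    ← mul_one (∫⁻ v, f v ∂μ), ← hκ1, h.lintegral_mul hf hκ]
  refine lintegral_congr fun v => ?_
  rw [lintegral_leafMap hf, Pi.mul_apply, ← mul_assoc]

/-! ### Harmonic functions and the Cayley transform -/

/-- Near g z, f is the real part of a holomorphic F, so the composite is the real part of F ∘ g. -/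
theorem _root_.InnerProductSpace.HarmonicAt.comp_analyticAt {f : ℂ → ℝ} {g : ℂ → ℂ} {z : ℂ}
    (hf : InnerProductSpace.HarmonicAt f (g z)) (hg : AnalyticAt ℂ g z) :
    InnerProductSpace.HarmonicAt (fun w => f (g w)) z := by
  obtain ⟨ε, hε, h⟩ := Metric.isOpen_iff.1 (InnerProductSpace.isOpen_setOfPred_harmonicAt f) _ hf
  obtain ⟨F, hF, hFf⟩ :=
    InnerProductSpace.HarmonicOnNhd.exists_analyticOnNhd_ball_re_eq fun _ hy => h hy
  have hFg : AnalyticAt ℂ (fun w => F (g w)) z :=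
    (hF _ (Metric.mem_ball_self hε)).comp hg
  refine (InnerProductSpace.harmonicAt_congr_nhds ?_).1 hFg.harmonicAt_re
  filter_upwards [hg.continuousAt.preimage_mem_nhds (Metric.ball_mem_nhds _ hε)] with w hw
  exact hFf hw

/-- The factor y² never vanishes, so hyperbolic and Euclidean harmonicity agree. -/
theorem isHarmonicFunction_iff {h : ℍ → ℝ} : IsHarmonicFunction h ↔
    ∀ z : ℂ, 0 < z.im → InnerProductSpace.HarmonicAt (fun w : ℂ => h (ofComplex w)) z := by
  constructor
  · rintro ⟨h1, h2⟩ z hz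
    refine ⟨h1 ⟨z, hz⟩, ?_⟩
    filter_upwards [(isOpen_lt continuous_const Complex.continuous_im).mem_nhds hz] with w hw
    have h3 := h2 ⟨w, hw⟩
    rw [hypLaplacian, mul_eq_zero] at h3
    exact h3.resolve_left (pow_ne_zero 2 (UpperHalfPlane.im_ne_zero _))
  · intro H
    refine ⟨fun z => (H z z.im_pos).1, fun z => ?_⟩
    rw [hypLaplacian, (H z z.im_pos).2.self_of_nhds]
    simp

theorem IsHarmonicFunction.continuous {h : ℍ → ℝ} (hh : IsHarmonicFunction h) : Continuous h := by
  refine continuous_iff_continuousAt.2 fun z => ?_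
  have := ((hh.1 z).continuousAt).comp (f := UpperHalfPlane.coe)
    UpperHalfPlane.continuous_coe.continuousAt
  simpa [Function.comp_def] using this

/-- The Cayley transform. -/
def cayley (z : ℂ) : ℂ := (z - Complex.I) / (z + Complex.I)

/-- The inverse Cayley transform. -/
def cayleyInv (w : ℂ) : ℂ := Complex.I * (1 + w) / (1 - w)

theorem add_I_ne_zero {z : ℂ} (hz : 0 < z.im) : z + Complex.I ≠ 0 := by
  intro h
  have := congrArg Complex.im h
  simp at this
  linarith

theorem one_sub_ne_zero {w : ℂ} (hw : ‖w‖ < 1) : 1 - w ≠ 0 := by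
  intro h
  rw [← sub_eq_zero.1 h] at hw
  simp at hw

theorem analyticAt_cayley {z : ℂ} (hz : 0 < z.im) : AnalyticAt ℂ cayley z :=
  (analyticAt_id.sub analyticAt_const).div (analyticAt_id.add analyticAt_const) (add_I_ne_zero hz)

theorem analyticAt_cayleyInv {w : ℂ} (hw : ‖w‖ < 1) : AnalyticAt ℂ cayleyInv w :=
  (analyticAt_const.mul (analyticAt_const.add analyticAt_id)).div
    (analyticAt_const.sub analyticAt_id) (one_sub_ne_zero hw)

theorem norm_cayley_lt {z : ℂ} (hz : 0 < z.im) : ‖cayley z‖ < 1 := by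
  have h := norm_pos_iff.2 (add_I_ne_zero hz)
  rw [cayley, norm_div, div_lt_one h]
  refine lt_of_pow_lt_pow_left₀ 2 h.le ?_
  rw [← Complex.normSq_eq_norm_sq, ← Complex.normSq_eq_norm_sq]
  simp [Complex.normSq_apply]
  nlinarith

theorem cayleyInv_im_pos {w : ℂ} (hw : ‖w‖ < 1) : 0 < (cayleyInv w).im := by
  have h : Complex.normSq w < 1 := by
    rw [Complex.normSq_eq_norm_sq]
    exact pow_lt_one₀ (norm_nonneg _) hw two_ne_zero
  have h' := Complex.normSq_pos.2 (one_sub_ne_zero hw)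
  have : (cayleyInv w).im = (1 - Complex.normSq w) / Complex.normSq (1 - w) := by
    rw [cayleyInv, Complex.div_im, ← sub_div]
    congr 1
    simp [Complex.normSq_apply]
    ring
  rw [this]
  exact div_pos (by linarith) h'

theorem cayleyInv_cayley {z : ℂ} (hz : 0 < z.im) : cayleyInv (cayley z) = z := by
  have h := add_I_ne_zero hz
  have h' := one_sub_ne_zero (norm_cayley_lt hz)
  rw [cayleyInv, div_eq_iff h']
  rw [cayley]
  field_simp
  ring

theorem cayley_cayleyInv {w : ℂ} (hw : ‖w‖ < 1) : cayley (cayleyInv w) = w := by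
  have h := one_sub_ne_zero hw
  have h' := add_I_ne_zero (cayleyInv_im_pos hw)
  rw [cayley, div_eq_iff h']
  have hI := Complex.I_ne_zero
  rw [cayleyInv]
  field_simp
  ring

theorem poisson_eq_poissonKernel (ξ : Circle) (z : ℍ) :
    poisson ξ z = poissonKernel 0 (cayley z) ξ := by
  have h := add_I_ne_zero z.coe_im_pos
  have hn : Complex.normSq (z + Complex.I) ≠ 0 := by simpa using h
  have e1 : (ξ : ℂ) - cayley z = (ξ * (z + Complex.I) - (z - Complex.I)) / (z + Complex.I) := by
    rw [cayley, eq_div_iff h, sub_mul, div_mul_cancel₀ _ h]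
  have e2 : Complex.normSq (z + Complex.I) - Complex.normSq (z - Complex.I) = 4 * z.im := by
    simp [Complex.normSq_apply]
    ring
  rw [poissonKernel_def, sub_zero, sub_zero, e1, Circle.norm_coe, cayley,
    ← Complex.normSq_eq_norm_sq, ← Complex.normSq_eq_norm_sq, Complex.normSq_div,
    Complex.normSq_div, poisson, ← e2]
  field_simp

/-! ### Poisson integrals -/

theorem poissonLIntegral_lt_top (ν : Measure Circle) [IsFiniteMeasure ν] (z : ℍ) :
    poissonLIntegral ν z < ⊤ := by
  obtain ⟨M, hM⟩ := exists_poisson_bounds (isCompact_singleton (x := z))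
  calc poissonLIntegral ν z ≤ ∫⁻ _, ENNReal.ofReal M ∂ν :=
        lintegral_mono fun ξ => ENNReal.ofReal_le_ofReal (hM ξ z rfl).1
    _ < ⊤ := by
        rw [lintegral_const]
        exact ENNReal.mul_lt_top ENNReal.ofReal_lt_top (measure_lt_top _ _)

theorem continuous_poisson_left (z : ℍ) : Continuous fun ξ => poisson ξ z :=
  continuous_poisson.comp (continuous_id.prodMk continuous_const)

theorem poissonLIntegral_pos {ν : Measure Circle} (hν : ν ≠ 0) (z : ℍ) :
    0 < poissonLIntegral ν z := by
  rw [poissonLIntegral, lintegral_pos_iff_support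
    (continuous_poisson_left z).measurable.ennreal_ofReal]
  have : (Function.support fun ξ => ENNReal.ofReal (poisson ξ z)) = Set.univ := by
    ext ξ
    simp [poisson_pos]
  rw [this]
  exact Measure.measure_univ_pos.2 hν

theorem toReal_poissonLIntegral (ν : Measure Circle) (z : ℍ) :
    (poissonLIntegral ν z).toReal = ∫ ξ, poisson ξ z ∂ν := by
  rw [integral_eq_lintegral_of_nonneg_ae (.of_forall fun ξ => (poisson_pos ξ z).le)
    (continuous_poisson_left z).aestronglyMeasurable]
  rfl

theorem continuous_herglotzRieszKernel {w : ℂ} (hw : ‖w‖ < 1) :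
    Continuous fun ξ : Circle => herglotzRieszKernel 0 w ξ := by
  simp only [herglotzRieszKernel_def, sub_zero]
  refine (continuous_circleCoe.add continuous_const).div
    (continuous_circleCoe.sub continuous_const) fun (ξ : Circle) h => ?_
  have hξ := Circle.norm_coe ξ
  rw [← sub_eq_zero.1 h] at hw
  exact hw.ne hξ

theorem _root_.Continuous.integrable_circle {E : Type*} [NormedAddCommGroup E]
    [SecondCountableTopology E] {f : Circle → E} (hf : Continuous f) (ν : Measure Circle)
    [IsFiniteMeasure ν] : Integrable f ν := by
  obtain ⟨C, hC⟩ := (isCompact_range hf.norm).bddAbove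
  exact Integrable.of_bound hf.aestronglyMeasurable C (.of_forall fun ξ => hC ⟨ξ, rfl⟩)

theorem differentiableAt_integral_herglotzRieszKernel (ν : Measure Circle) [IsFiniteMeasure ν]
    {w : ℂ} (hw : ‖w‖ < 1) :
    DifferentiableAt ℂ (fun w => ∫ ξ : Circle, herglotzRieszKernel 0 w ξ ∂ν) w := by
  obtain ⟨r, hwr, hr⟩ := exists_between hw
  have hball : Metric.ball (0 : ℂ) r ∈ nhds w :=
    Metric.isOpen_ball.mem_nhds (by simpa using hwr)
  have hne : ∀ x ∈ Metric.ball (0 : ℂ) r, ∀ ξ : Circle, 1 - r ≤ ‖(ξ : ℂ) - x‖ := by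
    intro x hx ξ
    have := norm_sub_norm_le (ξ : ℂ) x
    rw [Circle.norm_coe] at this
    rw [mem_ball_zero_iff] at hx
    linarith
  have hne' : ∀ x ∈ Metric.ball (0 : ℂ) r, ∀ ξ : Circle, (ξ : ℂ) - x ≠ 0 := fun x hx ξ =>
    norm_pos_iff.1 (lt_of_lt_of_le (by linarith) (hne x hx ξ))
  have hwball : w ∈ Metric.ball (0 : ℂ) r := by simpa using hwr
  -- The derivative of (ξ + w) / (ξ - w) in w is 2 ξ / (ξ - w) ^ 2, and |ξ - w| ≥ 1 - r on the ball
  -- of radius r.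
  refine (hasDerivAt_integral_of_dominated_loc_of_deriv_le (bound := fun _ => 2 / (1 - r) ^ 2)
    (F := fun w (ξ : Circle) => herglotzRieszKernel 0 w ξ)
    (F' := fun w (ξ : Circle) => 2 * (ξ : ℂ) / (ξ - w) ^ 2) hball ?_ ?_ ?_ ?_ ?_
    ?_).2.differentiableAt
  · filter_upwards [hball] with x hx
    rw [mem_ball_zero_iff] at hx
    exact (continuous_herglotzRieszKernel (hx.trans hr)).aestronglyMeasurable
  · exact (continuous_herglotzRieszKernel hw).integrable_circle ν
  · refine Continuous.aestronglyMeasurable (Continuous.div ?_ ?_ fun ξ =>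
      pow_ne_zero 2 (hne' w hwball ξ))
    · exact continuous_const.mul continuous_circleCoe
    · exact (continuous_circleCoe.sub continuous_const).pow 2
  · refine .of_forall fun ξ x hx => ?_
    rw [norm_div, norm_mul, Circle.norm_coe, norm_pow, Complex.norm_ofNat, mul_one]
    have := hne x hx ξ
    have h1 : 0 < 1 - r := by linarith
    gcongr
  · exact integrable_const _
  · refine .of_forall fun ξ x hx => ?_
    have h := (((hasDerivAt_id x).const_add (ξ : ℂ)).div ((hasDerivAt_id x).const_sub (ξ : ℂ))
      (hne' x hx ξ))
    simp only [herglotzRieszKernel_def, sub_zero]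
    convert! h using 1
    simp
    ring

/-- The Poisson integral of a finite measure is harmonic. -/
theorem isHarmonicFunction_poissonLIntegral (ν : Measure Circle) [IsFiniteMeasure ν] :
    IsHarmonicFunction fun z => (poissonLIntegral ν z).toReal := by
  refine isHarmonicFunction_iff.2 fun z hz => ?_
  -- The Poisson kernel is the real part of the Herglotz kernel, so the Poisson integral is the real
  -- part of this holomorphic function.
  have hG : AnalyticAt ℂ (fun w => ∫ ξ : Circle, herglotzRieszKernel 0 w ξ ∂ν) (cayley z) := by
    refine DifferentiableOn.analyticAt (s := Metric.ball 0 1) (fun w hw => ?_)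
      (Metric.isOpen_ball.mem_nhds (by simpa using norm_cayley_lt hz))
    exact (differentiableAt_integral_herglotzRieszKernel ν
      (by simpa using hw)).differentiableWithinAt
  refine (InnerProductSpace.harmonicAt_congr_nhds ?_).1
    (hG.harmonicAt_re.comp_analyticAt (analyticAt_cayley hz))
  filter_upwards [(isOpen_lt continuous_const Complex.continuous_im).mem_nhds hz] with w hw
  have hi := (continuous_herglotzRieszKernel (norm_cayley_lt hw)).integrable_circle ν
  rw [toReal_poissonLIntegral, ← RCLike.re_eq_complex_re, ← integral_re hi]
  refine integral_congr_ae (.of_forall fun ξ => ?_)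
  change (herglotzRieszKernel 0 (cayley w) (ξ : Circle)).re = poisson ξ (ofComplex w)
  rw [poisson_eq_poissonKernel, poissonKernel_eq_re_herglotzRieszKernel,
    UpperHalfPlane.ofComplex_apply_of_im_pos hw]
  rfl

/-! ### The Poisson formula on the circle -/

/-- The rotation invariant probability measure on the circle. -/
def angleMeasure : Measure Circle :=
  ENNReal.ofReal (2 * Real.pi)⁻¹ • (volume.restrict (Set.Ioc 0 (2 * Real.pi))).map Circle.exp

instance : IsFiniteMeasure angleMeasure := Measure.smul_finite _ ENNReal.ofReal_ne_top

theorem circleAverage_eq_integral {f : ℂ → ℝ} (hf : Continuous fun ξ : Circle => f ξ) :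
    Real.circleAverage f 0 1 = ∫ ξ : Circle, f ξ ∂angleMeasure := by
  rw [angleMeasure, integral_smul_measure, integral_map Circle.exp.continuous.aemeasurable
    hf.aestronglyMeasurable, Real.circleAverage_def,
    intervalIntegral.integral_of_le Real.two_pi_pos.le,
    ENNReal.toReal_ofReal (inv_nonneg.2 Real.two_pi_pos.le)]
  simp [circleMap, Circle.coe_exp]

theorem _root_.Continuous.poissonKernel_circle {X : Type*} [TopologicalSpace X] {w : X → ℂ}
    {ξ : X → Circle} (hw : Continuous w) (hw' : ∀ x, ‖w x‖ < 1) (hξ : Continuous ξ) :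
    Continuous fun x => poissonKernel 0 (w x) (ξ x) := by
  have h2 : Continuous fun x => (ξ x : ℂ) := continuous_circleCoe.comp hξ
  simp only [poissonKernel_def, sub_zero]
  refine ((h2.norm.pow 2).sub (hw.norm.pow 2)).div ((h2.sub hw).norm.pow 2) fun x h => ?_
  have h3 := hw' x
  have h5 : (ξ x : ℂ) = w x := by
    simpa [sub_eq_zero] using h
  rw [← h5, Circle.norm_coe] at h3
  exact lt_irrefl _ h3

theorem integral_poissonKernel_mul {f : ℂ → ℝ}
    (hf : InnerProductSpace.HarmonicOnNhd f (Metric.closedBall 0 1)) {w : ℂ} (hw : ‖w‖ < 1) :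
    ∫ ξ : Circle, poissonKernel 0 w ξ * f ξ ∂angleMeasure = f w := by
  have hc : Continuous fun ξ : Circle => f ξ := by
    refine hf.continuousOn.comp_continuous continuous_circleCoe fun (ξ : Circle) => ?_
    have := Circle.norm_coe ξ
    simpa using this.le
  rw [← hf.circleAverage_poissonKernel_smul (by simpa using hw), circleAverage_eq_integral]
  · rfl
  · exact (continuous_const.poissonKernel_circle (fun _ => hw) continuous_id).mul hc

theorem norm_coe_div_two_lt (ξ : Circle) : ‖(ξ : ℂ) / 2‖ < 1 := by
  rw [norm_div, Circle.norm_coe]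
  norm_num

theorem poissonKernel_div_two_comm (ξ ζ : Circle) :
    poissonKernel 0 ((ξ : ℂ) / 2) ζ = poissonKernel 0 ((ζ : ℂ) / 2) ξ := by
  have h : ‖(ζ : ℂ) - ξ / 2‖ ^ 2 = ‖(ξ : ℂ) - ζ / 2‖ ^ 2 := by
    have h1 := Circle.normSq_coe ξ
    have h2 := Circle.normSq_coe ζ
    rw [Complex.normSq_apply] at h1 h2
    rw [← Complex.normSq_eq_norm_sq, ← Complex.normSq_eq_norm_sq]
    simp [Complex.normSq_apply]
    linear_combination (3 / 4) * h2 - (3 / 4) * h1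
  simp only [poissonKernel_def, sub_zero, norm_div, Circle.norm_coe, h]

/-- Poisson's formula for f at ξ / 2, Fubini, and the symmetry |ζ - ξ / 2| = |ξ - ζ / 2| on the
circle. The right side sees ν only through its Poisson integral on the circle of radius 1/2. -/
theorem integral_div_two {f : ℂ → ℝ}
    (hf : InnerProductSpace.HarmonicOnNhd f (Metric.closedBall 0 1)) (ν : Measure Circle)
    [IsFiniteMeasure ν] :
    ∫ ξ : Circle, f ((ξ : ℂ) / 2) ∂ν =
      ∫ ζ : Circle, (∫ ξ : Circle, poissonKernel 0 ((ζ : ℂ) / 2) ξ ∂ν) * f ζ ∂angleMeasure := by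
  have hc : Continuous fun ξ : Circle => f ξ := by
    refine hf.continuousOn.comp_continuous continuous_circleCoe fun (ξ : Circle) => ?_
    have := Circle.norm_coe ξ
    simpa using this.le
  have hk : Continuous fun q : Circle × Circle =>
      poissonKernel 0 ((q.1 : ℂ) / 2) q.2 * f q.2 :=
    (((continuous_circleCoe.comp continuous_fst).div_const 2).poissonKernel_circle
      (fun q => norm_coe_div_two_lt _) continuous_snd).mul (hc.comp continuous_snd)
  obtain ⟨C, hC⟩ := (isCompact_range hk.norm).bddAbove
  have hi : Integrable (fun q : Circle × Circle =>
      poissonKernel 0 ((q.1 : ℂ) / 2) q.2 * f q.2) (ν.prod angleMeasure) :=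
    Integrable.of_bound hk.aestronglyMeasurable C (.of_forall fun q => hC ⟨q, rfl⟩)
  calc ∫ ξ : Circle, f ((ξ : ℂ) / 2) ∂ν
      = ∫ ξ : Circle, ∫ ζ : Circle, poissonKernel 0 ((ξ : ℂ) / 2) ζ * f ζ ∂angleMeasure ∂ν :=
        integral_congr_ae (.of_forall fun ξ =>
          (integral_poissonKernel_mul hf (norm_coe_div_two_lt ξ)).symm)
    _ = ∫ ζ : Circle, ∫ ξ : Circle, poissonKernel 0 ((ξ : ℂ) / 2) ζ * f ζ ∂ν ∂angleMeasure :=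
        integral_integral_swap hi
    _ = _ := by
        refine integral_congr_ae (.of_forall fun (ζ : Circle) => ?_)
        simp only [poissonKernel_div_two_comm _ ζ]
        exact integral_mul_const _ _

/-! ### Uniqueness of the representing measure -/

open scoped BoundedContinuousFunction

/-- A finite measure on the circle is determined by its Fourier coefficients. -/
theorem measure_circle_ext {ν₁ ν₂ : Measure Circle} [IsFiniteMeasure ν₁] [IsFiniteMeasure ν₂]
    (h : ∀ n : ℕ, ∫ ξ : Circle, (ξ : ℂ) ^ n ∂ν₁ = ∫ ξ : Circle, (ξ : ℂ) ^ n ∂ν₂) : ν₁ = ν₂ := by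
  have hz : ∀ n : ℤ, ∫ ξ : Circle, ((ξ ^ n : Circle) : ℂ) ∂ν₁ =
      ∫ ξ : Circle, ((ξ ^ n : Circle) : ℂ) ∂ν₂ := by
    intro n
    obtain ⟨n, rfl | rfl⟩ := n.eq_nat_or_neg
    · simpa using h n
    · have e : ∀ ξ : Circle, ((ξ ^ (-(n : ℤ)) : Circle) : ℂ) = starRingEnd ℂ ((ξ : ℂ) ^ n) := by
        intro ξ
        rw [zpow_neg, Circle.coe_inv_eq_conj, zpow_natCast, Circle.coe_pow]
      simp only [e]
      rw [integral_conj, integral_conj, h n]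
  set c : Circle →ᵇ ℂ := BoundedContinuousFunction.mkOfCompact ⟨fun ξ => ξ, continuous_circleCoe⟩
    with hcdef
  have hc : ∀ ξ, c ξ = ξ := fun _ => rfl
  refine ext_of_forall_mem_subalgebra_integral_eq_of_polish (𝕜 := ℂ)
    (A := StarAlgebra.adjoin ℂ {c}) ?_ fun g hg => ?_
  · intro x y hxy
    refine ⟨fun ξ => ξ, ⟨⟨fun ξ => ξ, continuous_circleCoe⟩, ⟨c, ?_, rfl⟩, rfl⟩, ?_⟩
    · exact StarAlgebra.self_mem_adjoin_singleton ℂ c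
    · exact fun h => hxy (Circle.ext h)
  -- The star algebra is the linear span of the monoid generated by c and its conjugate, whose
  -- elements are the integer powers of ξ. It separates points, so the integrals of these powers
  -- suffice.
  · have hg' : g ∈ Submodule.span ℂ
        (Submonoid.closure ({c} ∪ star {c} : Set (Circle →ᵇ ℂ)) : Set (Circle →ᵇ ℂ)) := by
      rw [← Algebra.adjoin_eq_span, ← StarAlgebra.adjoin_toSubalgebra]
      exact hg
    have hpow : ∀ g ∈ Submonoid.closure ({c} ∪ star {c} : Set (Circle →ᵇ ℂ)),
        ∃ n : ℤ, ∀ ξ : Circle, g ξ = ((ξ ^ n : Circle) : ℂ) := by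
      intro g hg
      induction hg using Submonoid.closure_induction with
      | mem g hg =>
        rcases hg with hg | hg
        · exact ⟨1, fun ξ => by rw [Set.mem_singleton_iff.1 hg, zpow_one]; rfl⟩
        · refine ⟨-1, fun ξ => ?_⟩
          rw [Set.star_singleton, Set.mem_singleton_iff] at hg
          rw [hg, zpow_neg_one, Circle.coe_inv_eq_conj]
          rfl
      | one => exact ⟨0, fun ξ => by simp⟩
      | mul f g _ _ hf hg =>
        obtain ⟨m, hm⟩ := hf
        obtain ⟨n, hn⟩ := hg
        exact ⟨m + n, fun ξ => by
          rw [BoundedContinuousFunction.mul_apply, hm, hn, zpow_add, Circle.coe_mul]⟩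
    clear hg
    induction hg' using Submodule.span_induction with
    | mem g hg =>
      obtain ⟨n, hn⟩ := hpow g hg
      simp only [hn]
      exact hz n
    | zero => simp
    | add f g _ _ hf hg =>
      simp only [BoundedContinuousFunction.add_apply]
      rw [integral_add (f.integrable _) (g.integrable _),
        integral_add (f.integrable _) (g.integrable _), hf, hg]
    | smul a f _ hf =>
      simp only [BoundedContinuousFunction.smul_apply]
      rw [integral_smul, integral_smul, hf]

/-- By `integral_div_two` the Poisson integral determines the integral of f (ξ / 2) for f harmonic
near the closed disc. The real and imaginary parts of (2 w) ^ n then recover the Fourier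
coefficients. -/
theorem eq_of_poissonLIntegral_eq {ν₁ ν₂ : Measure Circle} [IsFiniteMeasure ν₁]
    [IsFiniteMeasure ν₂] (h : ∀ z, poissonLIntegral ν₁ z = poissonLIntegral ν₂ z) : ν₁ = ν₂ := by
  have hk : ∀ w : ℂ, ‖w‖ < 1 → ∫ ξ : Circle, poissonKernel 0 w ξ ∂ν₁ =
      ∫ ξ : Circle, poissonKernel 0 w ξ ∂ν₂ := by
    intro w hw
    have := congrArg ENNReal.toReal (h ⟨cayleyInv w, cayleyInv_im_pos hw⟩)
    simpa only [toReal_poissonLIntegral, poisson_eq_poissonKernel, UpperHalfPlane.coe_mk,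
      cayley_cayleyInv hw] using this
  have hf : ∀ f : ℂ → ℝ, InnerProductSpace.HarmonicOnNhd f (Metric.closedBall 0 1) →
      ∫ ξ : Circle, f ((ξ : ℂ) / 2) ∂ν₁ = ∫ ξ : Circle, f ((ξ : ℂ) / 2) ∂ν₂ := by
    intro f hf
    rw [integral_div_two hf, integral_div_two hf]
    simp only [hk _ (norm_coe_div_two_lt _)]
  refine measure_circle_ext fun n => ?_
  have han : ∀ w : ℂ, AnalyticAt ℂ (fun w : ℂ => (2 * w) ^ n) w := fun w => by fun_prop
  have hint : ∀ (ν : Measure Circle) [IsFiniteMeasure ν],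
      Integrable (fun ξ : Circle => (ξ : ℂ) ^ n) ν := fun ν _ =>
    (continuous_circleCoe.pow n).integrable_circle ν
  have hre := hf _ fun w _ => (han w).harmonicAt_re
  have him := hf _ fun w _ => (han w).harmonicAt_im
  have e : ∀ ξ : Circle, 2 * ((ξ : ℂ) / 2) = ξ := fun ξ => by ring
  simp only [e] at hre him
  apply Complex.ext
  · have h1 := integral_re (hint ν₁)
    have h2 := integral_re (hint ν₂)
    simp only [RCLike.re_eq_complex_re] at h1 h2
    rw [← h1, ← h2, hre]
  · have h1 := integral_im (hint ν₁)
    have h2 := integral_im (hint ν₂)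
    simp only [RCLike.im_eq_complex_im] at h1 h2
    rw [← h1, ← h2, him]

/-! ### The Herglotz representation -/

open Filter in
/-- Herglotz representation: a positive harmonic function on the unit disc is the Poisson integral
of a finite measure on the circle. -/
theorem exists_integral_poissonKernel_eq {u : ℂ → ℝ}
    (hu : InnerProductSpace.HarmonicOnNhd u (Metric.ball 0 1)) (hpos : ∀ w, ‖w‖ < 1 → 0 < u w) :
    ∃ P : ProbabilityMeasure Circle, ∀ w, ‖w‖ < 1 →
      u w = u 0 * ∫ ξ : Circle, poissonKernel 0 w ξ ∂(P : Measure Circle) := by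
  have hu0 : 0 < u 0 := hpos 0 (by simp)
  -- The dilates u (r n · w) are harmonic up to the boundary, where Poisson's formula applies.
  set r : ℕ → ℝ := fun n => 1 - 1 / ((n : ℝ) + 1) with hrdef
  have hr0 : ∀ n, 0 ≤ r n := fun n => by
    have : (1 : ℝ) / ((n : ℝ) + 1) ≤ 1 := by
      rw [div_le_one (by positivity)]
      linarith [n.cast_nonneg (α := ℝ)]
    simp only [hrdef]
    linarith
  have hr1 : ∀ n, r n < 1 := fun n => by
    have : 0 < (1 : ℝ) / ((n : ℝ) + 1) := by positivity
    simp only [hrdef]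
    linarith
  have hrlim : Tendsto r atTop (nhds 1) := by
    simpa [hrdef] using tendsto_one_div_add_atTop_nhds_zero_nat.const_sub (1 : ℝ)
  have hball : ∀ n, ∀ w : ℂ, ‖w‖ ≤ 1 → ‖(r n : ℂ) * w‖ < 1 := fun n w hw => by
    rw [norm_mul, Complex.norm_real, Real.norm_of_nonneg (hr0 n)]
    nlinarith [hr0 n, hr1 n, norm_nonneg w]
  have hun : ∀ n, InnerProductSpace.HarmonicOnNhd (fun w => u (r n * w))
      (Metric.closedBall 0 1) := fun n w hw =>
    (hu _ (mem_ball_zero_iff.2 (hball n w (mem_closedBall_zero_iff.1 hw)))).comp_analyticAt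
      (by fun_prop)
  have hunc : ∀ n, Continuous fun ξ : Circle => u (r n * ξ) / u 0 := fun n => by
    refine Continuous.div_const ?_ _
    refine (hun n).continuousOn.comp_continuous continuous_circleCoe fun (ξ : Circle) => ?_
    have := Circle.norm_coe ξ
    simpa using this.le
  have hunpos : ∀ n, ∀ ξ : Circle, 0 ≤ u (r n * ξ) / u 0 := fun n ξ =>
    div_nonneg (hpos _ (hball n _ (Circle.norm_coe ξ).le)).le hu0.le
  set ν : ℕ → Measure Circle := fun n =>
    angleMeasure.withDensity fun ξ => ENNReal.ofReal (u (r n * ξ) / u 0) with hνdef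
  have hint : ∀ n, ∀ w : ℂ, ‖w‖ < 1 →
      ∫ ξ : Circle, poissonKernel 0 w ξ ∂(ν n) = u (r n * w) / u 0 := by
    intro n w hw
    have h := integral_poissonKernel_mul (hun n) hw
    rw [← h, hνdef, integral_withDensity_eq_integral_toReal_smul
      (hunc n).measurable.ennreal_ofReal (.of_forall fun _ => ENNReal.ofReal_lt_top),
      ← integral_div]
    refine integral_congr_ae (.of_forall fun (ξ : Circle) => ?_)
    simp only [ENNReal.toReal_ofReal (hunpos n ξ), smul_eq_mul]
    ring
  -- At w = 0 the kernel is 1, and dividing the density by u 0 makes the total mass 1.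
  have hprob : ∀ n, IsProbabilityMeasure (ν n) := fun n => by
    have h := hint n 0 (by simp)
    have h1 : ∀ ξ : Circle, poissonKernel 0 0 ξ = 1 := fun ξ => by
      simp [poissonKernel_def, Circle.norm_coe]
    have hfin : IsFiniteMeasure (ν n) := isFiniteMeasure_withDensity_ofReal
      ((hunc n).integrable_circle _).2
    simp only [h1, mul_zero, integral_const, smul_eq_mul, mul_one, div_self hu0.ne'] at h
    exact ⟨by rwa [Measure.real, ENNReal.toReal_eq_one_iff] at h⟩
  set Q : ℕ → ProbabilityMeasure Circle := fun n => ⟨ν n, hprob n⟩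
  -- Probability measures on the compact circle form a compact space, so a free ultrafilter gives a
  -- weak limit without extraction of a subsequence.
  obtain ⟨P, hP⟩ : ∃ P, Tendsto Q (hyperfilter ℕ) (nhds P) :=
    ⟨_, (Ultrafilter.map Q (hyperfilter ℕ)).le_nhds_lim⟩
  refine ⟨P, fun w hw => ?_⟩
  have hk : Continuous fun ξ : Circle => poissonKernel 0 w ξ :=
    continuous_const.poissonKernel_circle (fun _ => hw) continuous_id
  have h1 := ProbabilityMeasure.tendsto_iff_forall_integral_tendsto.1 hP
    (BoundedContinuousFunction.mkOfCompact ⟨_, hk⟩)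
  have h2 : Tendsto (fun n => u (r n * w) / u 0) (hyperfilter ℕ) (nhds (u w / u 0)) := by
    refine Tendsto.div_const ?_ _
    have hcont : ContinuousAt u w := (hu w (mem_ball_zero_iff.2 hw)).1.continuousAt
    have hlim : Tendsto (fun n => (r n : ℂ) * w) (hyperfilter ℕ) (nhds w) := by
      have := ((Complex.continuous_ofReal.tendsto _).comp hrlim).mul_const w
      simp only [Complex.ofReal_one, one_mul] at this
      exact this.mono_left Nat.hyperfilter_le_atTop
    exact hcont.tendsto.comp hlim
  have h3 := tendsto_nhds_unique h2 (h1.congr fun n => hint n w hw)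
  rw [div_eq_iff hu0.ne', mul_comm] at h3
  exact h3

/-- Herglotz's theorem carried to ℍ by the Cayley transform; the probability measure is rescaled by
the value of h at i, the image of 0. -/
theorem IsHarmonicFunction.exists_poissonLIntegral_eq {h : ℍ → ℝ} (hh : IsHarmonicFunction h)
    (hpos : ∀ z, 0 < h z) : ∃ ν : Measure Circle, IsFiniteMeasure ν ∧
      ∀ z, poissonLIntegral ν z = ENNReal.ofReal (h z) := by
  have hu : InnerProductSpace.HarmonicOnNhd (fun w => h (ofComplex (cayleyInv w)))
      (Metric.ball 0 1) := fun w hw =>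
    (isHarmonicFunction_iff.1 hh _ (cayleyInv_im_pos (mem_ball_zero_iff.1 hw))).comp_analyticAt
      (analyticAt_cayleyInv (mem_ball_zero_iff.1 hw))
  obtain ⟨P, hP⟩ := exists_integral_poissonKernel_eq hu fun w _ => hpos _
  set c := h (ofComplex (cayleyInv 0))
  refine ⟨ENNReal.ofReal c • (P : Measure Circle), Measure.smul_finite _ ENNReal.ofReal_ne_top,
    fun z => ?_⟩
  have h1 := hP (cayley z) (norm_cayley_lt z.coe_im_pos)
  rw [cayleyInv_cayley z.coe_im_pos, UpperHalfPlane.ofComplex_apply] at h1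
  simp only [← poisson_eq_poissonKernel] at h1
  rw [h1, ← toReal_poissonLIntegral, ENNReal.ofReal_mul (hpos _).le,
    ENNReal.ofReal_toReal (poissonLIntegral_lt_top _ z).ne, poissonLIntegral,
    lintegral_smul_measure]
  rfl

/-! ### Brunella's proposition -/

theorem isHarmonicMeasure_iff (m : Measure ℍ) : IsHarmonicMeasure m ↔
    ∃ μ : Measure UnitTangent, IsLocallyFiniteMeasure μ ∧ μ ≠ 0 ∧
      IsJointlyInvariant μ ∧ μ.map UnitTangent.base = m := by
  constructor
  · rintro ⟨h, hpos, hh, rfl⟩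
    obtain ⟨ν, hν, hνh⟩ := hh.exists_poissonLIntegral_eq hpos
    have hmap : (horoMeasure ν).map UnitTangent.base =
        (volume : Measure ℍ).withDensity fun z => ENNReal.ofReal (h z) := by
      rw [map_base_horoMeasure, funext hνh]
    refine ⟨horoMeasure ν, isLocallyFiniteMeasure_horoMeasure ν, ?_,
      isJointlyInvariant_horoMeasure ν, hmap⟩
    rintro h0
    have hν0 : ν ≠ 0 := by
      rintro rfl
      have := hνh UpperHalfPlane.I
      simp [poissonLIntegral, eq_comm, (hpos _).not_ge] at this
    rw [horoMeasure, Measure.map_eq_zero_iff continuous_horoChart.aemeasurable,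
      ← Measure.measure_univ_eq_zero, ← Set.univ_prod_univ, Measure.prod_prod, mul_eq_zero,
      Measure.measure_univ_eq_zero, Measure.measure_univ_eq_zero] at h0
    exact h0.elim hν0 (NeZero.ne _)
  · rintro ⟨μ, hμ, hμ0, hinv, rfl⟩
    obtain ⟨ν, hν, rfl⟩ := hinv.exists_eq_horoMeasure
    have hν0 : ν ≠ 0 := by
      rintro rfl
      simp [horoMeasure] at hμ0
    refine ⟨fun z => (poissonLIntegral ν z).toReal, fun z =>
      ENNReal.toReal_pos (poissonLIntegral_pos hν0 z).ne' (poissonLIntegral_lt_top ν z).ne,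
      isHarmonicFunction_poissonLIntegral ν, ?_⟩
    rw [map_base_horoMeasure]
    congr 1
    funext z
    rw [ENNReal.ofReal_toReal (poissonLIntegral_lt_top ν z).ne]

theorem IsJointlyInvariant.eq_of_map_base_eq {μ₁ μ₂ : Measure UnitTangent}
    [IsLocallyFiniteMeasure μ₁] [IsLocallyFiniteMeasure μ₂] (i₁ : IsJointlyInvariant μ₁)
    (i₂ : IsJointlyInvariant μ₂)
    (heq : μ₁.map UnitTangent.base = μ₂.map UnitTangent.base) : μ₁ = μ₂ := by
  obtain ⟨ν₁, hν₁, rfl⟩ := i₁.exists_eq_horoMeasure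
  obtain ⟨ν₂, hν₂, rfl⟩ := i₂.exists_eq_horoMeasure
  refine congrArg _ (eq_of_poissonLIntegral_eq fun z => ?_)
  rw [map_base_horoMeasure, map_base_horoMeasure, withDensity_eq_iff_of_sigmaFinite
    (measurable_poissonLIntegral _).aemeasurable
    (measurable_poissonLIntegral _).aemeasurable] at heq
  -- Equal projections give densities equal almost everywhere; both are continuous, so they agree at
  -- every point.
  have h := (isHarmonicFunction_poissonLIntegral ν₁).continuous.ae_eq_iff_eq volume
    (isHarmonicFunction_poissonLIntegral ν₂).continuous |>.1
    (heq.mono fun z hz => congrArg ENNReal.toReal hz)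
  exact (ENNReal.toReal_eq_toReal_iff' (poissonLIntegral_lt_top ν₁ z).ne
    (poissonLIntegral_lt_top ν₂ z).ne).1 (congrFun h z)

end HypPlane

end

theorem proposition1p1 :
    (∀ m : Measure ℍ, HypPlane.IsHarmonicMeasure m ↔
      ∃ μ : Measure HypPlane.UnitTangent, IsLocallyFiniteMeasure μ ∧ μ ≠ 0 ∧
        HypPlane.IsJointlyInvariant μ ∧ μ.map HypPlane.UnitTangent.base = m) ∧
    (∀ μ₁ μ₂ : Measure HypPlane.UnitTangent,
      IsLocallyFiniteMeasure μ₁ → IsLocallyFiniteMeasure μ₂ →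
      HypPlane.IsJointlyInvariant μ₁ → HypPlane.IsJointlyInvariant μ₂ →
      μ₁ ≠ μ₂ → μ₁.map HypPlane.UnitTangent.base ≠ μ₂.map HypPlane.UnitTangent.base) := by
  exact ⟨HypPlane.isHarmonicMeasure_iff, fun _ _ _ _ i₁ i₂ hne heq =>
    hne (i₁.eq_of_map_base_eq i₂ heq)⟩
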